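/- Setting. Let $n,d\ge 1$, $X\in\mathbb R^{n\times d}$, $y=X\alpha^\star+\xi$ with $\xi\sim N(0,I_n)$, $R_n(\alpha)=\frac1n\|X\alpha-y\|_2^2$ and $R(\alpha)=\frac1n\|X(\alpha-\alpha^\star)\|_2^2$. Let $K=\mathrm{conv}\{k_1,\dots,k_M\}\subset\mathbb R^d$ contain the origin in its interior, let $\varphi_K(\alpha)=\inf\{s>0:\alpha\in sK\}$, and let $\tau>0$. Write $D_\psi(\alpha,\alpha')=\psi(\alpha)-\psi(\alpha')-\langle\nabla\psi(\alpha'),\alpha-\alpha'\rangle$. A potential $\psi:\mathbb R^d\to[0,\infty)$ satisfies the continuous-time (discrete-time) conditions for $(K,\tau)$ with constants $c_l,c_u>0$ if: (I) $\psi$ is twice differentiable (differentiable) and $\nabla\psi(0)=0$; (II) $\sqrt\psi$ is convex; (III) $\psi$ is strictly convex ($\rho$-strongly convex for some $\rho>0$, i.e. $D_\psi(\alpha,\alpha')\ge\frac\rho2\|\alpha-\alpha'\|_2^2$ for all $\alpha,\alpha'$); (IV) $\varphi_K\le c_l\sqrt\psi$ on $\mathbb R^d$ and $\sqrt\psi\le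 c_u\tau$ on $\tau K$. Put $c_a=c_lc_u$. Mirror descent with potential $\psi$ is started at $\alpha_0=0$. In continuous time, $\psi$ is twice differentiable with positive definite Hessian and $\frac{d}{dt}\alpha_t=-(\nabla^2\psi(\alpha_t))^{-1}\nabla R_n(\alpha_t)$ for $t\ge0$. In discrete time, $\psi$ is differentiable and strictly convex with surjective gradient and $\nabla\psi(\alpha_{t+1})=\nabla\psi(\alpha_t)-\eta\nabla R_n(\alpha_t)$ with a step size $\eta>0$. Proposition. There is an absolute constant $C>0$ such that the following holds. Suppose that $\varphi_K(\alpha)=\max_{i\in[m]}\langle a_i,\alpha\rangle$ for all $\alpha\in\mathbb R^d$, with $\sum_{i=1}^m a_i=0$. Let $\rho=2/\max_{i\in[M]}\|k_i\|_2^2$, let $\gamma\ge 2\log(m)/\tau$, and $$\psi(\alpha)=\frac1{\gamma^2}\log^2\Big(m\sum_{i=1}^m\exp(\gamma\langle a_i,\alpha\rangle)\Big)+\frac\rho2\|\alpha\|_2^2 .$$ Then $\psi$ satisfies both the continuous-time and the discrete-time conditions, with this $\rho$ for the $\ell_2$-norm and with $c_l=1$, $c_u=3$, hence $c_a=3$;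 and $\psi$ is an admissible potential for mirror descent in continuous and in discrete time. Moreover, let $\phi=\max_{i\in[M]}\|Xk_i\|_2/\sqrt n$, suppose that $M\ge\tau\phi\sqrt n$, and put $$B=\min\Big\{\frac{\mathrm{rank}(X)}{n},\ c_a\,\tau\phi\sqrt{\frac{\log(eM/(\tau\phi\sqrt n))}{n}}\Big\}\qquad(B=0\text{ if }X=0).$$ With probability at least $0.99-\exp(-0.1n)$ over the draw of $\xi$, simultaneously for all $\alpha^\star\in\tau K$, optimally stopped mirror descent achieves $$R(\alpha_{t^\star})\le C\,B,\qquad t^\star\in\operatorname*{arg\,min}_{0\le t\le T}R(\alpha_t)\neq\emptyset ,$$ in continuous time for every horizon $T\ge c_u^2\tau^2/B$, and in discrete time for every integer horizon $T\ge 2c_u^2\tau^2/(B\eta)$, provided that $R_n$ is $\beta$-smooth for the $\ell_2$-norm for some $\beta>0$, i.e. $R_n(\alpha)\le R_n(\alpha')+\langle\nabla R_n(\alpha'),\alpha-\alpha'\rangle+\frac\beta2\|\alpha-\alpha'\|_2^2$ for all $\alpha,\alpha'$, that $\eta\le\rho/\beta$ and, if $\alpha^\star\ne0$, that $\eta\le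 D_\psi(\alpha^\star,0)/2$. (If $X=0$, any $T\ge0$ is allowed.) -/

import Mathlib

open scoped Pointwise

noncomputable section

namespace ESMD

/-- `ℝ^d` with the Euclidean norm and inner product. -/
abbrev Vec (d : ℕ) : Type := EuclideanSpace ℝ (Fin d)

/-! ### Convex analysis and potentials -/

/-- Bregman divergence `D_ψ(α, α') = ψ(α) - ψ(α') - ⟨∇ψ(α'), α - α'⟩`. -/
def bregman {d : ℕ} (ψ : Vec d → ℝ) (α α' : Vec d) : ℝ :=
  ψ α - ψ α' - inner ℝ (gradient ψ α') (α - α')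

/-- `ψ` is `ρ`-strongly convex with respect to the `ℓ₂`-norm:
`D_ψ(α, α') ≥ (ρ/2) ‖α - α'‖²` for all `α, α'`. -/
def IsStronglyConvex {d : ℕ} (ρ : ℝ) (ψ : Vec d → ℝ) : Prop :=
  ∀ α α' : Vec d, ρ / 2 * ‖α - α'‖ ^ 2 ≤ bregman ψ α α'

/-- `f` is `β`-smooth with respect to the `ℓ₂`-norm:
`f(α) ≤ f(α') + ⟨∇f(α'), α - α'⟩ + (β/2) ‖α - α'‖²` for all `α, α'`. -/
def IsSmooth {d : ℕ} (β : ℝ) (f : Vec d → ℝ) : Prop :=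
  ∀ α α' : Vec d,
    f α ≤ f α' + inner ℝ (gradient f α') (α - α') + β / 2 * ‖α - α'‖ ^ 2

/-- The Hessian of `ψ` at `α`, as the derivative of the gradient field. -/
def hessian {d : ℕ} (ψ : Vec d → ℝ) (α : Vec d) : Vec d →L[ℝ] Vec d :=
  fderiv ℝ (gradient ψ) α

/-- Condition (IV) on a potential: `φ_K ≤ c_l √ψ` on `ℝ^d` and `√ψ ≤ c_u τ` on `τ K`, where
`φ_K = gauge K` is the Minkowski functional. -/
def ApproximatesGauge {d : ℕ} (K : Set (Vec d)) (τ cl cu : ℝ) (ψ : Vec d → ℝ) : Prop :=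
  0 < cl ∧ 0 < cu ∧
    (∀ α : Vec d, gauge K α ≤ cl * √(ψ α)) ∧
    (∀ α ∈ τ • K, √(ψ α) ≤ cu * τ)

/-- The continuous-time version of the conditions (I)-(IV) on a potential `ψ : ℝ^d → [0, ∞)`. -/
structure ContinuousTimeConditions {d : ℕ} (K : Set (Vec d)) (τ cl cu : ℝ)
    (ψ : Vec d → ℝ) : Prop where
  nonneg : ∀ α, 0 ≤ ψ α
  differentiable : Differentiable ℝ ψ
  differentiable_gradient : Differentiable ℝ (gradient ψ)
  gradient_zero : gradient ψ 0 = 0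
  convex_sqrt : ConvexOn ℝ Set.univ (fun α => √(ψ α))
  strictConvex : StrictConvexOn ℝ Set.univ ψ
  approximates : ApproximatesGauge K τ cl cu ψ

/-- The discrete-time version of the conditions (I)-(IV) on a potential `ψ : ℝ^d → [0, ∞)`,
with strong convexity parameter `ρ > 0` for the `ℓ₂`-norm. -/
structure DiscreteTimeConditions {d : ℕ} (K : Set (Vec d)) (τ cl cu ρ : ℝ)
    (ψ : Vec d → ℝ) : Prop where
  nonneg : ∀ α, 0 ≤ ψ α
  differentiable : Differentiable ℝ ψ
  gradient_zero : gradient ψ 0 = 0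
  convex_sqrt : ConvexOn ℝ Set.univ (fun α => √(ψ α))
  rho_pos : 0 < ρ
  stronglyConvex : IsStronglyConvex ρ ψ
  approximates : ApproximatesGauge K τ cl cu ψ

/-! ### Mirror descent -/

/-- What is required of a potential for continuous-time mirror descent to be defined: twice
differentiable with positive definite Hessian everywhere. -/
structure IsContinuousTimeMirrorMap {d : ℕ} (ψ : Vec d → ℝ) : Prop where
  differentiable : Differentiable ℝ ψ
  differentiable_gradient : Differentiable ℝ (gradient ψ)
  hessian_posDef : ∀ α v : Vec d, v ≠ 0 → 0 < inner ℝ (hessian ψ α v) v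

/-- What is required of a potential for discrete-time mirror descent to be defined:
differentiable, strictly convex, with surjective gradient. -/
structure IsDiscreteTimeMirrorMap {d : ℕ} (ψ : Vec d → ℝ) : Prop where
  differentiable : Differentiable ℝ ψ
  strictConvex : StrictConvexOn ℝ Set.univ ψ
  gradient_surjective : Function.Surjective (gradient ψ)

/-- `α` is a continuous-time mirror descent path on the objective `f` with potential `ψ`, started
at `0`: `α'(t) = -(∇²ψ(α(t)))⁻¹ ∇f(α(t))` for all `t ≥ 0` (one-sided derivative at `t = 0`). -/
def IsContinuousTimeMD {d : ℕ} (ψ f : Vec d → ℝ) (α : ℝ → Vec d) : Prop :=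
  α 0 = 0 ∧ ∀ t : ℝ, 0 ≤ t →
    HasDerivWithinAt α (-((hessian ψ (α t)).inverse (gradient f (α t)))) (Set.Ici 0) t

/-- `α` is the sequence of discrete-time mirror descent iterates on the objective `f` with
potential `ψ` and step size `η`, started at `0`. -/
def IsDiscreteTimeMD {d : ℕ} (ψ f : Vec d → ℝ) (η : ℝ) (α : ℕ → Vec d) : Prop :=
  α 0 = 0 ∧ ∀ t : ℕ, gradient ψ (α (t + 1)) = gradient ψ (α t) - η • gradient f (α t)

/-! ### Linear regression -/

/-- The vector `X α` in `ℝ^n`. -/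
def apply {n d : ℕ} (X : Matrix (Fin n) (Fin d) ℝ) (α : Vec d) : Vec n :=
  Matrix.toEuclideanLin X α

/-- Empirical risk `R_n(α) = (1/n) ‖X α - y‖²`. -/
def empiricalRisk {n d : ℕ} (X : Matrix (Fin n) (Fin d) ℝ) (y : Vec n) (α : Vec d) : ℝ :=
  1 / (n : ℝ) * ‖apply X α - y‖ ^ 2

/-- In-sample risk `R(α) = (1/n) ‖X (α - α⋆)‖²`. -/
def inSampleRisk {n d : ℕ} (X : Matrix (Fin n) (Fin d) ℝ) (αstar α : Vec d) : ℝ :=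
  1 / (n : ℝ) * ‖apply X (α - αstar)‖ ^ 2

/-! ### `M`-convex hulls -/

/-- The convex hull of the `M` points `k_1, …, k_M`. -/
def mHull {d M : ℕ} (k : Fin M → Vec d) : Set (Vec d) :=
  convexHull ℝ (Set.range k)

/-- `ρ = 2 / max_i ‖k_i‖²`. -/
def hullRho {d M : ℕ} (k : Fin M → Vec d) : ℝ :=
  2 / ⨆ i, ‖k i‖ ^ 2

/-- The log-sum-exp squared potential
`(1/γ²) log²(m ∑_i exp(γ ⟨a_i, α⟩)) + (ρ/2) ‖α‖²`. -/
def lsePotential {d m : ℕ} (a : Fin m → Vec d) (γ ρ : ℝ) (α : Vec d) : ℝ :=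
  1 / γ ^ 2 * (Real.log ((m : ℝ) * ∑ i, Real.exp (γ * inner ℝ (a i) α))) ^ 2
    + ρ / 2 * ‖α‖ ^ 2

/-- `φ = max_i ‖X k_i‖ / √n`. -/
def hullPhi {n d M : ℕ} (X : Matrix (Fin n) (Fin d) ℝ) (k : Fin M → Vec d) : ℝ :=
  (⨆ i, ‖apply X (k i)‖) / √(n : ℝ)

/-- The rate `min(rank(X)/n, c_a τ φ √(log(e M / (τ φ √n)) / n))`. -/
def hullRate {n d M : ℕ} (X : Matrix (Fin n) (Fin d) ℝ) (k : Fin M → Vec d) (τ ca : ℝ) : ℝ :=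
  min ((X.rank : ℝ) / n)
    (ca * τ * hullPhi X k *
      √(Real.log (Real.exp 1 * M / (τ * hullPhi X k * √(n : ℝ))) / n))

end ESMD

end

open ESMD

namespace ESMD

/-! The potential is `F² + (ρ/2)‖·‖²`, where `F` is a smooth convex substitute for the gauge of `K`,
nonnegative because the `a_i` sum to zero. Its square root is the Euclidean norm of the pair `(F,
√(ρ/2)‖·‖)`, hence `(√ψ(x) - √ψ(y))² ≤ D_ψ(x, y)` (`sqrt_sub_sq_le_bregman`). An iterate whose
divergence from `α⋆` is `O(τ²)` therefore lies in a fixed multiple of `τK`.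

Mirror descent supplies such an iterate: minimising the divergence plus a linear function of time
gives an iterate with excess empirical risk at most `B` and controlled divergence
(`IsContinuousTimeMD.exists_le`, `IsDiscreteTimeMD.exists_le`).

For that iterate put `u = X(α - α⋆)`. Small excess risk says `‖u‖² ≤ nB + 2⟨u, ξ⟩`, so it suffices
to bound `⟨u, ξ⟩ - ‖u‖²/4` uniformly over admissible `u`. Projecting the noise on the range of `X`
gives the rank term (`exists_event_sq_inner_le`). For the other term, `u` lies in a hull of `2M`
points; Maurey's method replaces it by an average of few of them, and a union bound with an
exponential moment covers all such averages (`exists_event_hull`). Neither event depends on `α⋆`;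
`exists_event_risk` combines them. Optimal stopping can only improve on the iterate found. -/

lemma le_log_sum_exp_tangent {m : ℕ} (hm : 0 < m) (u v : Fin m → ℝ) :
    Real.log (m * ∑ i, Real.exp (u i)) +
        ∑ i, Real.exp (u i) / (∑ j, Real.exp (u j)) * (v i - u i) ≤
      Real.log (m * ∑ i, Real.exp (v i)) := by
  have : Nonempty (Fin m) := ⟨⟨0, hm⟩⟩
  have hm' : (0 : ℝ) < m := by exact_mod_cast hm
  have hpos : ∀ w : Fin m → ℝ, 0 < ∑ i, Real.exp (w i) := fun w =>
    Finset.sum_pos (fun i _ => Real.exp_pos _) Finset.univ_nonempty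
  have hS := hpos u
  -- Jensen for `exp` with the softmax weights of `u`; taking logarithms gives the tangent
  -- inequality.
  have hj := convexOn_exp.map_sum_le (t := Finset.univ)
    (w := fun i => Real.exp (u i) / (∑ j, Real.exp (u j))) (p := fun i => v i - u i)
    (fun i _ => by positivity) (by rw [← Finset.sum_div, div_self hS.ne']) (fun i _ => Set.mem_univ _)
  simp only [smul_eq_mul] at hj
  have e : ∑ i, Real.exp (u i) / (∑ j, Real.exp (u j)) * Real.exp (v i - u i) =
      (∑ i, Real.exp (v i)) / ∑ j, Real.exp (u j) := by
    rw [Finset.sum_div]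
    refine Finset.sum_congr rfl fun i _ => ?_
    rw [Real.exp_sub]
    field_simp
  rw [e, ← Real.le_log_iff_exp_le (by have := hpos v; positivity),
    Real.log_div (hpos v).ne' hS.ne'] at hj
  rw [Real.log_mul hm'.ne' hS.ne', Real.log_mul hm'.ne' (hpos v).ne']
  linarith

/-! ### The log-sum-exp function -/

/-- The normalised logarithm of the sum of exponentials of linear functionals. -/
noncomputable def lse {d m : ℕ} (a : Fin m → Vec d) (γ : ℝ) (α : Vec d) : ℝ :=
  1 / γ * Real.log ((m : ℝ) * ∑ i, Real.exp (γ * inner ℝ (a i) α))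

/-- The gradient of `lse`. -/
noncomputable def lseGrad {d m : ℕ} (a : Fin m → Vec d) (γ : ℝ) (α : Vec d) : Vec d :=
  ∑ i, (Real.exp (γ * inner ℝ (a i) α) / ∑ j, Real.exp (γ * inner ℝ (a j) α)) • a i

section lse

variable {d m : ℕ} (a : Fin m → Vec d) {γ : ℝ}

lemma lsePotential_eq (ρ : ℝ) (α : Vec d) :
    lsePotential a γ ρ α = lse a γ α ^ 2 + ρ / 2 * ‖α‖ ^ 2 := by
  simp only [lsePotential, lse]
  ring

lemma lse_tangent (hm : 0 < m) (hγ : 0 < γ) (x y : Vec d) :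
    lse a γ y + inner ℝ (lseGrad a γ y) (x - y) ≤ lse a γ x := by
  have h := le_log_sum_exp_tangent hm (fun i => γ * inner ℝ (a i) y)
    (fun i => γ * inner ℝ (a i) x)
  have h2 := mul_le_mul_of_nonneg_left h (one_div_pos.2 hγ).le
  refine le_of_eq_of_le ?_ h2
  rw [mul_add, lse, lseGrad, sum_inner]
  congr 1
  rw [Finset.mul_sum]
  refine Finset.sum_congr rfl fun i _ => ?_
  rw [real_inner_smul_left, inner_sub_right]
  field_simp

lemma contDiff_lse (hm : 0 < m) : ContDiff ℝ 2 (lse a γ) := by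
  have : Nonempty (Fin m) := ⟨⟨0, hm⟩⟩
  have hm' : (0 : ℝ) < m := by exact_mod_cast hm
  unfold lse
  refine contDiff_const.mul (ContDiff.log ?_ ?_)
  · refine contDiff_const.mul (ContDiff.sum fun i _ => ?_)
    exact (contDiff_const.mul (contDiff_const.inner ℝ contDiff_id)).exp
  · intro x
    have : 0 < ∑ i, Real.exp (γ * inner ℝ (a i) x) :=
      Finset.sum_pos (fun i _ => Real.exp_pos _) Finset.univ_nonempty
    positivity

lemma hasGradientAt_lse (hm : 0 < m) (hγ : 0 < γ) (y : Vec d) :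
    HasGradientAt (lse a γ) (lseGrad a γ y) y := by
  have : Nonempty (Fin m) := ⟨⟨0, hm⟩⟩
  have hm' : (0 : ℝ) < m := by exact_mod_cast hm
  have hS : 0 < ∑ i, Real.exp (γ * inner ℝ (a i) y) :=
    Finset.sum_pos (fun i _ => Real.exp_pos _) Finset.univ_nonempty
  rw [hasGradientAt_iff_hasFDerivAt]
  have h1 : ∀ i, HasFDerivAt (fun α : Vec d => Real.exp (γ * inner ℝ (a i) α))
      (Real.exp (γ * inner ℝ (a i) y) • (γ • innerSL ℝ (a i))) y := fun i =>
    (((innerSL ℝ (a i)).hasFDerivAt (x := y)).const_mul γ).exp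
  have h2 := (((HasFDerivAt.fun_sum (u := Finset.univ) fun i _ => h1 i).const_mul (m : ℝ)).log
    (by positivity)).const_mul (1 / γ)
  refine h2.congr_fderiv ?_
  ext v
  simp only [smul_apply, sum_apply, innerSL_apply_apply,
    InnerProductSpace.toDual_apply_apply, lseGrad, sum_inner, smul_eq_mul, real_inner_smul_left]
  generalize ∑ j, Real.exp (γ * inner ℝ (a j) y) = S at hS
  rw [Finset.mul_sum, Finset.mul_sum, Finset.mul_sum]
  refine Finset.sum_congr rfl fun i _ => ?_
  field_simp

lemma lse_zero (hm : 0 < m) : lse a γ 0 = 2 * Real.log m / γ := by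
  have hm' : (0 : ℝ) < m := by exact_mod_cast hm
  simp only [lse, inner_zero_right, mul_zero, Real.exp_zero, Finset.sum_const, Finset.card_univ,
    Fintype.card_fin, nsmul_eq_mul, mul_one]
  rw [Real.log_mul hm'.ne' hm'.ne']
  ring

lemma lseGrad_zero (ha : ∑ i, a i = 0) : lseGrad a γ 0 = 0 := by
  simp only [lseGrad, inner_zero_right, mul_zero, Real.exp_zero]
  rw [← Finset.smul_sum, ha, smul_zero]

/-- Centring makes the origin a critical point, hence a global minimum by convexity. The resulting
nonnegativity is what allows squaring. -/
lemma lse_ge_zero (hm : 0 < m) (hγ : 0 < γ) (ha : ∑ i, a i = 0) (x : Vec d) :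
    2 * Real.log m / γ ≤ lse a γ x := by
  have := lse_tangent a hm hγ x 0
  rwa [lseGrad_zero a ha, inner_zero_left, add_zero, lse_zero a hm] at this

lemma iSup_inner_le_lse (hm : 0 < m) (hγ : 0 < γ) (x : Vec d) :
    ⨆ i, inner ℝ (a i) x ≤ lse a γ x := by
  have : Nonempty (Fin m) := ⟨⟨0, hm⟩⟩
  have hm' : (1 : ℝ) ≤ m := by exact_mod_cast hm
  refine ciSup_le fun i => ?_
  rw [lse, one_div, inv_mul_eq_div, le_div_iff₀ hγ, mul_comm]
  have h1 : Real.exp (γ * inner ℝ (a i) x) ≤ ∑ j, Real.exp (γ * inner ℝ (a j) x) :=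
    Finset.single_le_sum (f := fun j => Real.exp (γ * inner ℝ (a j) x))
      (fun j _ => (Real.exp_pos _).le) (Finset.mem_univ i)
  have h0 := Real.exp_pos (γ * inner ℝ (a i) x)
  rw [Real.le_log_iff_exp_le (by nlinarith)]
  nlinarith

lemma lse_le (hm : 0 < m) (hγ : 0 < γ) (x : Vec d) :
    lse a γ x ≤ 2 * Real.log m / γ + ⨆ i, inner ℝ (a i) x := by
  have : Nonempty (Fin m) := ⟨⟨0, hm⟩⟩
  have hm' : (0 : ℝ) < m := by exact_mod_cast hm
  set s := ⨆ i, inner ℝ (a i) x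
  have h1 : ∑ j, Real.exp (γ * inner ℝ (a j) x) ≤ m * Real.exp (γ * s) := by
    refine (Finset.sum_le_sum (g := fun _ => Real.exp (γ * s)) fun j _ => ?_).trans (by simp)
    have := le_ciSup (Set.finite_range fun i => inner ℝ (a i) x).bddAbove j
    exact Real.exp_le_exp.2 (mul_le_mul_of_nonneg_left this hγ.le)
  have hS : 0 < ∑ i, Real.exp (γ * inner ℝ (a i) x) :=
    Finset.sum_pos (fun i _ => Real.exp_pos _) Finset.univ_nonempty
  have h2 : Real.log ((m : ℝ) * ∑ i, Real.exp (γ * inner ℝ (a i) x)) ≤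
      2 * Real.log m + γ * s := by
    refine (Real.log_le_log (by positivity) (mul_le_mul_of_nonneg_left h1 hm'.le)).trans ?_
    rw [Real.log_mul hm'.ne' (by positivity), Real.log_mul hm'.ne' (by positivity), Real.log_exp]
    linarith
  rw [lse, one_div, inv_mul_eq_div, div_le_iff₀ hγ]
  rw [add_mul, div_mul_cancel₀ _ hγ.ne']
  linarith

end lse

/-! ### Potentials of the form `F² + (ρ/2)‖·‖²` -/

section quadratic

variable {d : ℕ} {F : Vec d → ℝ} {G : Vec d → Vec d} {ρ : ℝ}

lemma hasGradientAt_sq_add (hG : ∀ y, HasGradientAt F (G y) y) (y : Vec d) :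
    HasGradientAt (fun x => F x ^ 2 + ρ / 2 * ‖x‖ ^ 2) ((2 * F y) • G y + ρ • y) y := by
  rw [hasGradientAt_iff_hasFDerivAt]
  have h1 := ((hasGradientAt_iff_hasFDerivAt.1 (hG y)).pow 2).add
    (((hasStrictFDerivAt_norm_sq y).hasFDerivAt).const_mul (ρ / 2))
  refine h1.congr_fderiv ?_
  ext v
  simp
  ring

lemma bregman_sq_add (hG : ∀ y, HasGradientAt F (G y) y) (x y : Vec d) :
    bregman (fun x => F x ^ 2 + ρ / 2 * ‖x‖ ^ 2) x y =
      F x ^ 2 - F y ^ 2 - 2 * F y * inner ℝ (G y) (x - y) + ρ / 2 * ‖x - y‖ ^ 2 := by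
  rw [bregman, (hasGradientAt_sq_add hG y).gradient, inner_add_left, real_inner_smul_left,
    real_inner_smul_left, norm_sub_sq_real, inner_sub_right y, real_inner_self_eq_norm_sq,
    real_inner_comm x y]
  ring

/-- Multiplying the tangent inequality by `2 F y ≥ 0` bounds the divergence of `F²` below by a
perfect square. -/
lemma le_bregman_sq_add (hG : ∀ y, HasGradientAt F (G y) y)
    (hT : ∀ x y, F y + inner ℝ (G y) (x - y) ≤ F x) (h0 : ∀ x, 0 ≤ F x) (x y : Vec d) :
    (F x - F y) ^ 2 + ρ / 2 * ‖x - y‖ ^ 2 ≤ bregman (fun x => F x ^ 2 + ρ / 2 * ‖x‖ ^ 2) x y := by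
  rw [bregman_sq_add hG]
  nlinarith [hT x y, h0 y]

lemma sqrt_sub_sq_le {p q r s : ℝ} :
    (√(p ^ 2 + q ^ 2) - √(r ^ 2 + s ^ 2)) ^ 2 ≤ (p - r) ^ 2 + (q - s) ^ 2 := by
  have h1 := Real.sq_sqrt (show 0 ≤ p ^ 2 + q ^ 2 by positivity)
  have h2 := Real.sq_sqrt (show 0 ≤ r ^ 2 + s ^ 2 by positivity)
  have h3 : p * r + q * s ≤ √(p ^ 2 + q ^ 2) * √(r ^ 2 + s ^ 2) := by
    rw [← Real.sqrt_mul (by positivity)]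
    exact Real.le_sqrt_of_sq_le (by nlinarith [sq_nonneg (p * s - q * r)])
  nlinarith

lemma sqrt_add_sq_le {p q r s : ℝ} :
    √((p + r) ^ 2 + (q + s) ^ 2) ≤ √(p ^ 2 + q ^ 2) + √(r ^ 2 + s ^ 2) := by
  have h1 := Real.sq_sqrt (show 0 ≤ p ^ 2 + q ^ 2 by positivity)
  have h2 := Real.sq_sqrt (show 0 ≤ r ^ 2 + s ^ 2 by positivity)
  have h3 : p * r + q * s ≤ √(p ^ 2 + q ^ 2) * √(r ^ 2 + s ^ 2) := by
    rw [← Real.sqrt_mul (by positivity)]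
    exact Real.le_sqrt_of_sq_le (by nlinarith [sq_nonneg (p * s - q * r)])
  rw [Real.sqrt_le_left (by positivity)]
  nlinarith

/-- The reverse triangle inequality for the pair `(F, √(ρ/2)‖·‖)` in the plane. This turns control
of the divergence into control of the gauge. -/
lemma sqrt_sub_sq_le_bregman (hρ : 0 ≤ ρ) (hG : ∀ y, HasGradientAt F (G y) y)
    (hT : ∀ x y, F y + inner ℝ (G y) (x - y) ≤ F x) (h0 : ∀ x, 0 ≤ F x) (x y : Vec d) :
    (√(F x ^ 2 + ρ / 2 * ‖x‖ ^ 2) - √(F y ^ 2 + ρ / 2 * ‖y‖ ^ 2)) ^ 2 ≤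
      bregman (fun x => F x ^ 2 + ρ / 2 * ‖x‖ ^ 2) x y := by
  refine le_trans ?_ (le_bregman_sq_add hG hT h0 x y)
  have h := sqrt_sub_sq_le (p := F x) (q := √(ρ / 2) * ‖x‖) (r := F y) (s := √(ρ / 2) * ‖y‖)
  have hs := Real.sq_sqrt (show 0 ≤ ρ / 2 by positivity)
  rw [mul_pow, mul_pow, hs, ← mul_sub, mul_pow, hs] at h
  refine h.trans ?_
  have : (‖x‖ - ‖y‖) ^ 2 ≤ ‖x - y‖ ^ 2 := by
    rw [sq_le_sq, abs_norm]
    exact abs_norm_sub_norm_le x y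
  gcongr

lemma convexOn_of_tangent (hT : ∀ x y, F y + inner ℝ (G y) (x - y) ≤ F x) :
    ConvexOn ℝ Set.univ F := by
  refine ⟨convex_univ, fun x _ y _ a b ha hb hab => ?_⟩
  set z := a • x + b • y
  have h1 := mul_le_mul_of_nonneg_left (hT x z) ha
  have h2 := mul_le_mul_of_nonneg_left (hT y z) hb
  have h3 : a * inner ℝ (G z) (x - z) + b * inner ℝ (G z) (y - z) = 0 := by
    rw [← real_inner_smul_right, ← real_inner_smul_right, ← inner_add_right]
    have : a • (x - z) + b • (y - z) = (0 : Vec d) := by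
      rw [smul_sub, smul_sub, show a • x - a • z + (b • y - b • z) = z - (a + b) • z by
        rw [add_smul]; simp only [z]; abel, hab, one_smul, sub_self]
    rw [this, inner_zero_right]
  have : a * F z + b * F z = F z := by rw [← add_mul, hab, one_mul]
  simp only [smul_eq_mul]
  linarith

/-- The Euclidean norm in the plane is convex, and monotone on the positive quadrant, so it
preserves convexity of a pair of nonnegative convex functions. -/
lemma convexOn_sqrt_sq_add (hρ : 0 ≤ ρ) (hF : ConvexOn ℝ Set.univ F) (h0 : ∀ x, 0 ≤ F x) :
    ConvexOn ℝ Set.univ (fun x => √(F x ^ 2 + ρ / 2 * ‖x‖ ^ 2)) := by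
  have hs := Real.sq_sqrt (show 0 ≤ ρ / 2 by positivity)
  have e : ∀ x, F x ^ 2 + ρ / 2 * ‖x‖ ^ 2 = F x ^ 2 + (√(ρ / 2) * ‖x‖) ^ 2 := fun x => by
    rw [mul_pow, hs]
  simp only [e]
  refine ⟨convex_univ, fun x _ y _ a b ha hb hab => ?_⟩
  have h1 := hF.2 (Set.mem_univ x) (Set.mem_univ y) ha hb hab
  have h2 : ‖a • x + b • y‖ ≤ a * ‖x‖ + b * ‖y‖ := by
    refine (norm_add_le _ _).trans ?_
    rw [norm_smul, norm_smul, Real.norm_of_nonneg ha, Real.norm_of_nonneg hb]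
  have h3 : ∀ {c : ℝ} (p q : ℝ), 0 ≤ c →
      c * √(p ^ 2 + q ^ 2) = √((c * p) ^ 2 + (c * q) ^ 2) := fun {c} p q hc => by
    rw [mul_pow, mul_pow, ← mul_add, Real.sqrt_mul (by positivity), Real.sqrt_sq hc]
  simp only [smul_eq_mul] at h1 ⊢
  rw [h3 _ _ ha, h3 _ _ hb]
  refine le_trans (Real.sqrt_le_sqrt ?_) sqrt_add_sq_le
  have h4 := h0 (a • x + b • y)
  have h5 : √(ρ / 2) * ‖a • x + b • y‖ ≤ a * (√(ρ / 2) * ‖x‖) + b * (√(ρ / 2) * ‖y‖) :=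
    (mul_le_mul_of_nonneg_left h2 (Real.sqrt_nonneg _)).trans (by ring_nf; rfl)
  gcongr

end quadratic

/-! ### Strongly convex potentials as mirror maps -/

section mirror

variable {d : ℕ} {ρ : ℝ} {ψ : Vec d → ℝ}

lemma IsStronglyConvex.strictConvexOn (hρ : 0 < ρ) (h : IsStronglyConvex ρ ψ) :
    StrictConvexOn ℝ Set.univ ψ := by
  refine ⟨convex_univ, fun x _ y _ hxy a b ha hb hab => ?_⟩
  set z := a • x + b • y
  have e1 : x - z = b • (x - y) := by
    obtain rfl : b = 1 - a := by linarith
    simp only [z, smul_sub, sub_smul, one_smul]; abel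
  have e2 : y - z = -(a • (x - y)) := by
    obtain rfl : a = 1 - b := by linarith
    simp only [z, smul_sub, sub_smul, one_smul]; abel
  have h1 := h x z
  have h2 := h y z
  have hp : 0 < ‖x - y‖ := norm_pos_iff.2 (sub_ne_zero.2 hxy)
  rw [bregman, e1, norm_smul, real_inner_smul_right, Real.norm_of_nonneg hb.le] at h1
  rw [bregman, e2, norm_neg, norm_smul, inner_neg_right, real_inner_smul_right,
    Real.norm_of_nonneg ha.le] at h2
  have h3 := mul_le_mul_of_nonneg_left h1 ha.le
  have h4 := mul_le_mul_of_nonneg_left h2 hb.le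
  have h5 : 0 < a * (ρ / 2 * (b * ‖x - y‖) ^ 2) := by positivity
  have h6 : 0 < b * (ρ / 2 * (a * ‖x - y‖) ^ 2) := by positivity
  have : a * ψ z + b * ψ z = ψ z := by rw [← add_mul, hab, one_mul]
  simp only [smul_eq_mul]
  nlinarith

lemma ContDiff.gradient_differentiable (h : ContDiff ℝ 2 ψ) : Differentiable ℝ (gradient ψ) := by
  have h1 : Differentiable ℝ (fderiv ℝ ψ) :=
    (h.fderiv_right (m := 1) (by norm_num)).differentiable (by norm_num)
  exact (InnerProductSpace.toDual ℝ (Vec d)).symm.toContinuousLinearEquiv.differentiable.comp h1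

lemma IsStronglyConvex.gradient_monotone (h : IsStronglyConvex ρ ψ) (x y : Vec d) :
    ρ * ‖x - y‖ ^ 2 ≤ inner ℝ (gradient ψ x - gradient ψ y) (x - y) := by
  have h1 := h x y
  have h2 := h y x
  rw [bregman] at h1 h2
  rw [norm_sub_rev, ← neg_sub x y, inner_neg_right] at h2
  rw [inner_sub_left]
  linarith

/-- Strong monotonicity of the gradient bounds each difference quotient in direction `v`; the bound
passes to the one-sided limit. -/
lemma IsStronglyConvex.le_hessian (h : IsStronglyConvex ρ ψ)
    (hd : Differentiable ℝ (gradient ψ)) (x v : Vec d) :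
    ρ * ‖v‖ ^ 2 ≤ inner ℝ (hessian ψ x v) v := by
  have h1 : HasDerivAt (fun t : ℝ => gradient ψ (x + t • v)) (hessian ψ x v) 0 := by
    have h2 : HasDerivAt (fun t : ℝ => x + t • v) v 0 := by
      simpa using ((hasDerivAt_id (0 : ℝ)).smul_const v).const_add x
    have h3 : HasFDerivAt (gradient ψ) (hessian ψ x) (x + (0 : ℝ) • v) := by
      simpa [hessian] using (hd x).hasFDerivAt
    exact h3.comp_hasDerivAt (0 : ℝ) h2
  have h4 : HasDerivAt (fun t : ℝ => inner ℝ (gradient ψ (x + t • v)) v)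
      (inner ℝ (hessian ψ x v) v) 0 := by
    simpa using h1.inner ℝ (hasDerivAt_const (0 : ℝ) v)
  have h5 := h4.hasDerivWithinAt (s := Set.Ioi 0)
  rw [hasDerivWithinAt_iff_tendsto_slope' (by simp)] at h5
  refine ge_of_tendsto h5 ?_
  filter_upwards [self_mem_nhdsWithin] with t (ht : 0 < t)
  have h6 := h.gradient_monotone (x + t • v) x
  rw [add_sub_cancel_left, norm_smul, real_inner_smul_right, inner_sub_left,
    Real.norm_of_nonneg ht.le] at h6
  rw [slope_def_field, le_div_iff₀ (by linarith)]
  simp only [zero_smul, add_zero, sub_zero]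
  have : t * (ρ * ‖v‖ ^ 2 * t) ≤
      t * (inner ℝ (gradient ψ (x + t • v)) v - inner ℝ (gradient ψ x) v) := by
    nlinarith
  exact le_of_mul_le_mul_left this ht

/-- The function `ψ - ⟨g, ·⟩` grows quadratically, so it attains its minimum, where the gradient of
`ψ` is `g`. -/
lemma IsStronglyConvex.gradient_surjective (hρ : 0 < ρ) (h : IsStronglyConvex ρ ψ)
    (hd : Differentiable ℝ ψ) : Function.Surjective (gradient ψ) := by
  intro g
  set f : Vec d → ℝ := fun x => ψ x - inner ℝ g x
  have hf : Continuous f := hd.continuous.sub (by fun_prop)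
  have hlow : ∀ x, ψ 0 + ‖x‖ * (ρ / 2 * ‖x‖ - (‖gradient ψ 0‖ + ‖g‖)) ≤ f x := by
    intro x
    have h1 := h x 0
    rw [bregman, sub_zero] at h1
    have h2 := abs_le.1 (abs_real_inner_le_norm (gradient ψ 0) x)
    have h3 := abs_le.1 (abs_real_inner_le_norm g x)
    simp only [f]
    nlinarith [h2.1, h3.2]
  have hco : Filter.Tendsto f (Filter.cocompact _) Filter.atTop := by
    refine Filter.tendsto_atTop_mono hlow ?_
    have hn := tendsto_norm_cocompact_atTop (E := Vec d)
    refine Filter.tendsto_atTop_add_const_left _ _ (hn.atTop_mul_atTop₀ ?_)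
    exact Filter.tendsto_atTop_add_const_right _ _ (hn.const_mul_atTop (by positivity))
  obtain ⟨x, hx⟩ := hf.exists_forall_le hco
  refine ⟨x, ?_⟩
  have h1 : IsLocalMin f x := Filter.Eventually.of_forall hx
  have h2 : HasFDerivAt f (fderiv ℝ ψ x - innerSL ℝ g) x :=
    (hd x).hasFDerivAt.sub (innerSL ℝ g).hasFDerivAt
  have h3 := h1.hasFDerivAt_eq_zero h2
  rw [gradient, sub_eq_zero.1 h3]
  exact (InnerProductSpace.toDual ℝ (Vec d)).symm_apply_apply g

end mirror

/-! ### Geometry of the hull -/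

section hull

variable {d m M : ℕ} {k : Fin M → Vec d} {a : Fin m → Vec d}

lemma isBounded_mHull : Bornology.IsBounded (mHull k) :=
  isBounded_convexHull.2 (Set.finite_range k).isBounded

lemma absorbent_mHull (h0 : (0 : Vec d) ∈ interior (mHull k)) : Absorbent ℝ (mHull k) :=
  absorbent_nhds_zero (mem_interior_iff_mem_nhds.1 h0)

lemma exists_gauge_pos (hd : 0 < d) (h0 : (0 : Vec d) ∈ interior (mHull k)) :
    ∃ v : Vec d, 0 < gauge (mHull k) v := by
  have : Nonempty (Fin d) := ⟨⟨0, hd⟩⟩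
  obtain ⟨v, hv⟩ := exists_ne (0 : Vec d)
  refine ⟨v, (gauge_pos (absorbent_mHull h0) ?_).2 hv⟩
  exact (NormedSpace.isVonNBounded_iff ℝ).2 isBounded_mHull

lemma exists_ne_zero_of_mHull (hd : 0 < d) (h0 : (0 : Vec d) ∈ interior (mHull k)) :
    ∃ i, k i ≠ 0 := by
  by_contra! h
  obtain ⟨v, hv⟩ := exists_gauge_pos hd h0
  refine hv.ne' ?_
  rw [gauge_of_subset_zero, Pi.zero_apply]
  refine convexHull_min ?_ (convex_singleton 0)
  rintro _ ⟨i, rfl⟩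
  exact h i

/-- With fewer functionals, centring would make the gauge vanish, whereas a bounded set has a
nonzero gauge. This gives `log m > 0`, and hence `γ > 0`. -/
lemma two_le_of_gauge_eq (hd : 0 < d) (h0 : (0 : Vec d) ∈ interior (mHull k))
    (hg : ∀ α : Vec d, gauge (mHull k) α = ⨆ i, inner ℝ (a i) α) (ha : ∑ i, a i = 0) :
    2 ≤ m := by
  obtain ⟨v, hv⟩ := exists_gauge_pos hd h0
  rw [hg] at hv
  by_contra! hm
  interval_cases m
  · simp at hv
  · rw [Fin.sum_univ_one] at ha
    simp [ha, ciSup_unique] at hv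

lemma sq_norm_le_iSup (i : Fin M) : ‖k i‖ ^ 2 ≤ ⨆ i, ‖k i‖ ^ 2 :=
  le_ciSup (Set.finite_range fun i => ‖k i‖ ^ 2).bddAbove i

lemma iSup_sq_norm_pos (hd : 0 < d) (h0 : (0 : Vec d) ∈ interior (mHull k)) :
    0 < ⨆ i, ‖k i‖ ^ 2 := by
  obtain ⟨i, hi⟩ := exists_ne_zero_of_mHull hd h0
  exact lt_of_lt_of_le (pow_pos (norm_pos_iff.2 hi) 2) (sq_norm_le_iSup i)

lemma hullRho_pos (hd : 0 < d) (h0 : (0 : Vec d) ∈ interior (mHull k)) : 0 < hullRho k :=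
  div_pos two_pos (iSup_sq_norm_pos hd h0)

lemma hullRho_mul_le (hd : 0 < d) (h0 : (0 : Vec d) ∈ interior (mHull k)) {τ : ℝ} {α : Vec d}
    (hα : α ∈ τ • mHull k) : hullRho k / 2 * ‖α‖ ^ 2 ≤ τ ^ 2 := by
  obtain ⟨x, hx, rfl⟩ := hα
  have hs := iSup_sq_norm_pos hd h0
  have h1 : mHull k ⊆ Metric.closedBall 0 √(⨆ i, ‖k i‖ ^ 2) := by
    refine convexHull_min ?_ (convex_closedBall _ _)
    rintro _ ⟨i, rfl⟩
    rw [mem_closedBall_zero_iff]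
    exact Real.le_sqrt_of_sq_le (sq_norm_le_iSup i)
  have h2 := mem_closedBall_zero_iff.1 (h1 hx)
  have h3 : ‖x‖ ^ 2 ≤ ⨆ i, ‖k i‖ ^ 2 := by
    rw [← Real.sq_sqrt hs.le]
    gcongr
  have e : hullRho k / 2 = (⨆ i, ‖k i‖ ^ 2)⁻¹ := by
    rw [hullRho]
    field_simp
  simp only [norm_smul, mul_pow, Real.norm_eq_abs, sq_abs]
  rw [e, inv_mul_eq_div, div_le_iff₀ hs]
  exact mul_le_mul_of_nonneg_left h3 (sq_nonneg τ)

end hull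

/-! ### The potential satisfies all conditions -/

section potential

variable {d m M : ℕ} {k : Fin M → Vec d} {a : Fin m → Vec d} {τ γ : ℝ}

lemma lsePotential_funext (ρ : ℝ) :
    lsePotential a γ ρ = fun α => lse a γ α ^ 2 + ρ / 2 * ‖α‖ ^ 2 :=
  funext (lsePotential_eq a ρ)

lemma lsePotential_spec (hd : 0 < d) (h0 : (0 : Vec d) ∈ interior (mHull k))
    (hg : ∀ α : Vec d, gauge (mHull k) α = ⨆ i, inner ℝ (a i) α) (ha : ∑ i, a i = 0)
    (hτ : 0 < τ) (hγ : 2 * Real.log m / τ ≤ γ) {ψ : Vec d → ℝ}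
    (hψ : ψ = lsePotential a γ (hullRho k)) :
    ContinuousTimeConditions (mHull k) τ 1 3 ψ ∧
      DiscreteTimeConditions (mHull k) τ 1 3 (hullRho k) ψ ∧
      IsContinuousTimeMirrorMap ψ ∧ IsDiscreteTimeMirrorMap ψ ∧
      (∀ x y, (√(ψ x) - √(ψ y)) ^ 2 ≤ bregman ψ x y) ∧ 0 < ψ 0 := by
  have hm2 := two_le_of_gauge_eq hd h0 hg ha
  have hm : 0 < m := by omega
  have hlog : 0 < Real.log m := Real.log_pos (by exact_mod_cast hm2)
  have hγ0 : 0 < γ := lt_of_lt_of_le (by positivity) hγ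
  have hρ := hullRho_pos hd h0
  have hlow := lse_ge_zero a hm hγ0 ha
  have hc : 0 < 2 * Real.log m / γ := by positivity
  have hcτ : 2 * Real.log m / γ ≤ τ := by
    rw [div_le_iff₀ hτ] at hγ
    rw [div_le_iff₀ hγ0]
    linarith
  have hF0 : ∀ x, 0 ≤ lse a γ x := fun x => hc.le.trans (hlow x)
  have hG := hasGradientAt_lse a hm hγ0
  have hT := lse_tangent a hm hγ0
  rw [lsePotential_funext] at hψ
  have hgrad : ∀ y, HasGradientAt ψ ((2 * lse a γ y) • lseGrad a γ y + hullRho k • y) y := by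
    rw [hψ]
    exact hasGradientAt_sq_add hG
  have hnn : ∀ x, 0 ≤ ψ x := fun x => by rw [hψ]; positivity
  have hdiff : Differentiable ℝ ψ := fun x => (hgrad x).differentiableAt
  have hcd : ContDiff ℝ 2 ψ := by
    rw [hψ]
    exact ((contDiff_lse a hm).pow 2).add (contDiff_const.mul (contDiff_norm_sq ℝ))
  have hdg := ContDiff.gradient_differentiable hcd
  have hg0 : gradient ψ 0 = 0 := by
    rw [(hgrad 0).gradient, lseGrad_zero a ha, smul_zero, smul_zero, add_zero]
  have hcs : ConvexOn ℝ Set.univ (fun α => √(ψ α)) := by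
    rw [hψ]
    exact convexOn_sqrt_sq_add hρ.le (convexOn_of_tangent hT) hF0
  have hsc : IsStronglyConvex (hullRho k) ψ := fun x y => by
    rw [hψ]
    have := le_bregman_sq_add (ρ := hullRho k) hG hT hF0 x y
    nlinarith [sq_nonneg (lse a γ x - lse a γ y)]
  have hstr := hsc.strictConvexOn hρ
  have happ : ApproximatesGauge (mHull k) τ 1 3 ψ := by
    refine ⟨one_pos, three_pos, fun α => ?_, fun α hα => ?_⟩
    · rw [one_mul, hg, hψ]
      refine (iSup_inner_le_lse a hm hγ0 α).trans (Real.le_sqrt_of_sq_le ?_)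
      have : 0 ≤ hullRho k / 2 * ‖α‖ ^ 2 := by positivity
      linarith
    · have h1 := hullRho_mul_le hd h0 hα
      have h2 := lse_le a hm hγ0 α
      rw [← hg] at h2
      have h3 := gauge_le_of_mem hτ.le hα
      rw [hψ, Real.sqrt_le_left (by positivity)]
      -- The gauge and the smoothing error contribute `τ` each, and the quadratic term `τ²`: in
      -- total `5τ² ≤ (3τ)²`.
      have h4 : lse a γ α ^ 2 ≤ (2 * τ) ^ 2 := pow_le_pow_left₀ (hF0 α) (by linarith) 2
      nlinarith [sq_nonneg τ]
  refine ⟨⟨hnn, hdiff, hdg, hg0, hcs, hstr, happ⟩, ⟨hnn, hdiff, hg0, hcs, hρ, hsc, happ⟩,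
    ⟨hdiff, hdg, fun x v hv => ?_⟩, ⟨hdiff, hstr, hsc.gradient_surjective hρ hdiff⟩,
    fun x y => ?_, ?_⟩
  · have := norm_pos_iff.2 hv
    exact lt_of_lt_of_le (by positivity) (hsc.le_hessian hdg x v)
  · rw [hψ]
    exact sqrt_sub_sq_le_bregman hρ.le hG hT hF0 x y
  · rw [hψ]
    have := hlow 0
    have : 0 < lse a γ 0 := by linarith
    positivity

end potential

/-! ### Convergence of mirror descent -/

section mirror

variable {n d : ℕ} {X : Matrix (Fin n) (Fin d) ℝ} {y : Vec n} {ψ : Vec d → ℝ}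

lemma apply_eq (X : Matrix (Fin n) (Fin d) ℝ) (α : Vec d) :
    apply X α = LinearMap.toContinuousLinearMap (Matrix.toEuclideanLin X) α := rfl

lemma apply_sub (α β : Vec d) : apply X (α - β) = apply X α - apply X β := map_sub _ _ _

lemma apply_add (α β : Vec d) : apply X (α + β) = apply X α + apply X β := map_add _ _ _

lemma apply_smul (c : ℝ) (α : Vec d) : apply X (c • α) = c • apply X α := map_smul _ _ _

/-- Quadratic expansion of the empirical risk. -/
lemma inner_gradient_empiricalRisk (x z : Vec d) :
    inner ℝ (gradient (empiricalRisk X y) x) (z - x) =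
      empiricalRisk X y z - empiricalRisk X y x - inSampleRisk X x z := by
  set L := LinearMap.toContinuousLinearMap (Matrix.toEuclideanLin X)
  have h1 : HasFDerivAt (empiricalRisk X y)
      ((1 / (n : ℝ)) • (2 • (innerSL ℝ (L x - y)).comp L)) x :=
    ((L.hasFDerivAt.sub_const y).norm_sq).const_mul _
  have h2 : inner ℝ (gradient (empiricalRisk X y) x) (z - x) =
      1 / (n : ℝ) * (2 * inner ℝ (apply X x - y) (apply X (z - x))) := by
    rw [gradient, InnerProductSpace.toDual_symm_apply, h1.fderiv]
    simp [apply_eq, L, inner_sub_left]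
  have h3 : apply X z - y = (apply X x - y) + apply X (z - x) := by
    rw [apply_sub]; abel
  rw [h2, empiricalRisk, empiricalRisk, inSampleRisk, h3, norm_add_sq_real]
  ring

lemma inSampleRisk_nonneg (x z : Vec d) : 0 ≤ inSampleRisk X x z := by
  unfold inSampleRisk; positivity

lemma bregman_nonneg_of_sqrt (hb : ∀ x y, (√(ψ x) - √(ψ y)) ^ 2 ≤ bregman ψ x y) (x y : Vec d) :
    0 ≤ bregman ψ x y := (sq_nonneg _).trans (hb x y)

lemma bregman_zero (hg : gradient ψ 0 = 0) (x : Vec d) : bregman ψ x 0 = ψ x - ψ 0 := by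
  rw [bregman, hg, inner_zero_left, sub_zero]

/-- Positive definiteness gives injectivity, hence invertibility in finite dimension, so `inverse`
is not its default value `0`. -/
lemma IsContinuousTimeMirrorMap.hessian_inverse (h : IsContinuousTimeMirrorMap ψ) (x v : Vec d) :
    hessian ψ x ((hessian ψ x).inverse v) = v := by
  have hinj : Function.Injective (hessian ψ x).toLinearMap := by
    rw [← LinearMap.ker_eq_bot, LinearMap.ker_eq_bot']
    intro v hv
    by_contra hne
    have := h.hessian_posDef x v hne
    rw [show hessian ψ x v = 0 from hv, inner_zero_left] at this
    exact this.false
  let e := (LinearEquiv.ofInjectiveEndo _ hinj).toContinuousLinearEquiv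
  have he : hessian ψ x = (e : Vec d →L[ℝ] Vec d) := by ext; rfl
  rw [he, ContinuousLinearMap.inverse_equiv]
  exact e.apply_symm_apply v

/-- Along the flow the Bregman divergence to `z` decreases at the rate given by the objective. -/
lemma IsContinuousTimeMD.hasDerivWithinAt_bregman {f : Vec d → ℝ} {α : ℝ → Vec d}
    (hψ : IsContinuousTimeMirrorMap ψ) (h : IsContinuousTimeMD ψ f α) (z : Vec d)
    {t : ℝ} (ht : 0 ≤ t) :
    HasDerivWithinAt (fun s => bregman ψ z (α s))
      (inner ℝ (gradient f (α t)) (z - α t)) (Set.Ici 0) t := by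
  have hα := h.2 t ht
  set v := -((hessian ψ (α t)).inverse (gradient f (α t))) with hv
  have h1 : HasDerivWithinAt (fun s => ψ (α s)) (inner ℝ (gradient ψ (α t)) v) (Set.Ici 0) t :=
    (((hψ.differentiable (α t)).hasGradientAt).hasFDerivAt.comp_hasDerivWithinAt t hα).congr_deriv
      (by simp)
  have h2 : HasDerivWithinAt (fun s => gradient ψ (α s)) (hessian ψ (α t) v) (Set.Ici 0) t :=
    ((hψ.differentiable_gradient (α t)).hasFDerivAt).comp_hasDerivWithinAt t hα
  have h3 := (h1.const_sub (ψ z)).sub (h2.inner ℝ (hα.const_sub z))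
  refine h3.congr_deriv ?_
  -- The two terms `⟨∇ψ(α t), v⟩` cancel, and the Hessian undoes its inverse.
  rw [hv, map_neg, hψ.hessian_inverse]
  simp [inner_neg_left, inner_neg_right]

/-- Continuous-time mirror descent reaches an iterate that is nearly as good as `z` on the
objective while staying within the initial Bregman divergence of `z`. -/
lemma IsContinuousTimeMD.exists_le {α : ℝ → Vec d} (hψ : IsContinuousTimeMirrorMap ψ)
    (hb : ∀ x y, 0 ≤ bregman ψ x y) (h : IsContinuousTimeMD ψ (empiricalRisk X y) α)
    {z : Vec d} {B T : ℝ} (hB : 0 ≤ B) (hT0 : 0 ≤ T) (hT : bregman ψ z 0 < B * T) :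
    ∃ t ∈ Set.Icc 0 T, empiricalRisk X y (α t) - empiricalRisk X y z ≤ B ∧
      bregman ψ z (α t) ≤ bregman ψ z 0 := by
  have hd : ∀ t, 0 ≤ t → HasDerivWithinAt (fun s => bregman ψ z (α s) + B * s)
      (inner ℝ (gradient (empiricalRisk X y) (α t)) (z - α t) + B) (Set.Ici 0) t := fun t ht =>
    ((h.hasDerivWithinAt_bregman hψ z ht).add
      ((hasDerivWithinAt_id t (Set.Ici 0)).const_mul B)).congr_deriv (by simp)
  have hc : ContinuousOn (fun s => bregman ψ z (α s) + B * s) (Set.Icc 0 T) := fun t ht =>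
    ((hd t ht.1).continuousWithinAt).mono Set.Icc_subset_Ici_self
  -- The minimiser precedes `T`, since the value there is at least `B * T`, more than the initial
  -- value. Its right derivative is therefore nonnegative, which bounds the excess risk; comparison
  -- with time `0` bounds the divergence.
  obtain ⟨t, ht, hmin⟩ := isCompact_Icc.exists_isMinOn (Set.nonempty_Icc.2 hT0) hc
  have h0 := hmin (Set.left_mem_Icc.2 hT0)
  simp only [Set.mem_ofPred_eq, h.1, mul_zero, add_zero] at h0
  have htT : t < T := by
    refine lt_of_le_of_ne ht.2 fun e => ?_
    subst e
    linarith [hb z (α t)]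
  refine ⟨t, ht, ?_, by nlinarith [ht.1]⟩
  have hslope := ((hd t ht.1).mono (Set.Ioi_subset_Ici ht.1))
  rw [hasDerivWithinAt_iff_tendsto_slope' (by simp)] at hslope
  have hge : 0 ≤ inner ℝ (gradient (empiricalRisk X y) (α t)) (z - α t) + B := by
    refine ge_of_tendsto hslope ?_
    filter_upwards [Ioc_mem_nhdsGT htT] with s hs
    rw [slope_def_field]
    refine div_nonneg (sub_nonneg.2 ?_) (by linarith [hs.1])
    exact hmin ⟨ht.1.trans hs.1.le, hs.2⟩
  rw [inner_gradient_empiricalRisk] at hge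
  linarith [inSampleRisk_nonneg (X := X) (α t) z]

/-- One step of discrete-time mirror descent on a smooth objective. -/
lemma IsDiscreteTimeMD.bregman_succ_le {α : ℕ → Vec d} {β η ρ : ℝ} (hη : 0 < η) (hβ : 0 < β)
    (hρ : η ≤ ρ / β) (hψ : IsStronglyConvex ρ ψ) (hs : IsSmooth β (empiricalRisk X y))
    (h : IsDiscreteTimeMD ψ (empiricalRisk X y) η α) (z : Vec d) (t : ℕ) :
    bregman ψ z (α (t + 1)) ≤ bregman ψ z (α t) -
      η * (empiricalRisk X y (α (t + 1)) - empiricalRisk X y z) := by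
  have h1 := hψ (α (t + 1)) (α t)
  have h2 := hs (α (t + 1)) (α t)
  have h3 := inner_gradient_empiricalRisk (X := X) (y := y) (α t) z
  have h4 := inSampleRisk_nonneg (X := X) (α t) z
  -- The three-point identity. Since `η β ≤ ρ`, its negative divergence term absorbs the smoothness
  -- error.
  have h5 : bregman ψ z (α (t + 1)) = bregman ψ z (α t) - bregman ψ (α (t + 1)) (α t) +
      η * (inner ℝ (gradient (empiricalRisk X y) (α t)) (z - α t) -
        inner ℝ (gradient (empiricalRisk X y) (α t)) (α (t + 1) - α t)) := by
    rw [bregman, bregman, bregman, h.2 t, ← inner_sub_right, inner_sub_left, real_inner_smul_left,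
      sub_sub_sub_cancel_right, show z - α t = (z - α (t + 1)) + (α (t + 1) - α t) by abel,
      inner_add_right]
    ring
  rw [h3] at h5
  have h6 : η * (β / 2 * ‖α (t + 1) - α t‖ ^ 2) ≤ ρ / 2 * ‖α (t + 1) - α t‖ ^ 2 := by
    rw [le_div_iff₀ hβ] at hρ
    nlinarith [sq_nonneg ‖α (t + 1) - α t‖]
  nlinarith

/-- Discrete-time mirror descent reaches an iterate that is nearly as good as `z` on the
objective and whose Bregman divergence to `z` is controlled. -/
lemma IsDiscreteTimeMD.exists_le {α : ℕ → Vec d} {β η ρ : ℝ} (hη : 0 < η) (hβ : 0 < β)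
    (hρ : η ≤ ρ / β) (hψ : IsStronglyConvex ρ ψ) (hb : ∀ x y, 0 ≤ bregman ψ x y)
    (hs : IsSmooth β (empiricalRisk X y))
    (h : IsDiscreteTimeMD ψ (empiricalRisk X y) η α) {z : Vec d} {B V : ℝ} {T : ℕ} (hB : 0 ≤ B)
    (hV : ∀ x, -V ≤ empiricalRisk X y x - empiricalRisk X y z)
    (hT : bregman ψ z 0 < B * η * T) :
    ∃ t ≤ T, empiricalRisk X y (α t) - empiricalRisk X y z ≤ B ∧
      bregman ψ z (α t) ≤ bregman ψ z 0 + η * V := by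
  obtain ⟨t, ht, hmin⟩ := (Finset.range (T + 1)).exists_min_image
    (fun s : ℕ => bregman ψ z (α s) + B * η * s) ⟨0, by simp⟩
  have h0 := hmin 0 (by simp)
  simp only [h.1, Nat.cast_zero, mul_zero, add_zero] at h0
  rw [Finset.mem_range] at ht
  have htT : t < T := by
    refine lt_of_le_of_ne (by omega) fun e => ?_
    subst e
    linarith [hb z (α t)]
  have h1 := hmin (t + 1) (by rw [Finset.mem_range]; omega)
  have h2 := h.bregman_succ_le hη hβ hρ hψ hs z t
  have h3 : 0 ≤ B * η * t := by positivity
  -- The descent step bounds the risk of the new iterate, so the witness is the successor of the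
  -- minimiser. Its divergence may exceed the minimiser's by `η * V`.
  refine ⟨t + 1, htT, ?_, ?_⟩
  · push_cast at h1
    by_contra! hc
    nlinarith
  · nlinarith [hV (α (t + 1))]

end mirror

open MeasureTheory ProbabilityTheory

/-! ### Gaussian deviation bounds -/

section gaussian

variable {n : ℕ}

lemma map_inner_stdGaussian (z : Vec n) :
    (stdGaussian (Vec n)).map (fun ξ => inner ℝ z ξ) = gaussianReal 0 (‖z‖₊ ^ 2) := by
  have h := IsGaussian.map_eq_gaussianReal (μ := stdGaussian (Vec n)) (innerSL ℝ z)
  rw [integral_strongDual_stdGaussian, variance_dual_stdGaussian, innerSL_apply_norm] at h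
  have e : (‖z‖ ^ 2).toNNReal = ‖z‖₊ ^ 2 := by
    ext
    simp
  rwa [e] at h

lemma integrable_exp_inner_stdGaussian (z : Vec n) (μ : ℝ) :
    Integrable (fun ξ => Real.exp (μ * inner ℝ z ξ)) (stdGaussian (Vec n)) := by
  have h := integrable_exp_mul_gaussianReal (μ := 0) (v := ‖z‖₊ ^ 2) μ
  rw [← map_inner_stdGaussian] at h
  exact h.comp_measurable (by fun_prop)

lemma integral_exp_inner_stdGaussian (z : Vec n) (μ : ℝ) :
    ∫ ξ, Real.exp (μ * inner ℝ z ξ) ∂(stdGaussian (Vec n)) = Real.exp (μ ^ 2 * ‖z‖ ^ 2 / 2) := by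
  have h := mgf_gaussianReal (map_inner_stdGaussian z) μ
  rw [mgf] at h
  rw [h]
  simp
  ring

lemma integral_sq_inner_stdGaussian (z : Vec n) :
    ∫ ξ, (inner ℝ z ξ : ℝ) ^ 2 ∂(stdGaussian (Vec n)) = ‖z‖ ^ 2 := by
  have h := variance_dual_stdGaussian (E := Vec n) (innerSL ℝ z)
  rw [variance_of_integral_eq_zero (by fun_prop) (integral_strongDual_stdGaussian _),
    innerSL_apply_norm] at h
  simpa using h

lemma integrable_sq_inner_stdGaussian (z : Vec n) :
    Integrable (fun ξ => (inner ℝ z ξ : ℝ) ^ 2) (stdGaussian (Vec n)) :=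
  (IsGaussian.memLp_dual (stdGaussian (Vec n)) (innerSL ℝ z) 2 (by simp)).integrable_sq

lemma one_sub_le_measureReal_lt {f : Vec n → ℝ} (hf : ∀ ξ, 0 ≤ f ξ) (hm : Measurable f)
    (hi : Integrable f (stdGaussian (Vec n))) {c : ℝ} (hc : 0 < c) :
    1 - (∫ ξ, f ξ ∂(stdGaussian (Vec n))) / c ≤ (stdGaussian (Vec n)).real {ξ | f ξ < c} := by
  have h := mul_meas_ge_le_integral_of_nonneg (Filter.Eventually.of_forall hf) hi c
  have hE : MeasurableSet {ξ | c ≤ f ξ} := measurableSet_le measurable_const hm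
  have e : {ξ | f ξ < c} = {ξ | c ≤ f ξ}ᶜ := by ext; simp
  rw [e, probReal_compl_eq_one_sub hE]
  have : (stdGaussian (Vec n)).real {ξ | c ≤ f ξ} ≤ (∫ ξ, f ξ ∂(stdGaussian (Vec n))) / c := by
    rw [le_div_iff₀ hc, mul_comm]
    exact h
  linarith

/-- Uniform offset bound for a finite family of linear functionals of a Gaussian vector. -/
lemma exists_event_forall_inner_le {ι : Type*} [Fintype ι] [Nonempty ι] (z : ι → Vec n)
    {μ δ : ℝ} (hμ : 0 < μ) (hδ : 0 < δ) :
    ∃ E : Set (Vec n), MeasurableSet E ∧ 1 - δ ≤ (stdGaussian (Vec n)).real E ∧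
      ∀ ξ ∈ E, ∀ i, inner ℝ (z i) ξ ≤
        Real.log (Fintype.card ι / δ) / μ + μ / 2 * ‖z i‖ ^ 2 := by
  set N : ℝ := (Fintype.card ι : ℝ)
  have hN : 0 < N := by
    have := Fintype.card_pos (α := ι)
    exact Nat.cast_pos.2 this
  -- Each summand is normalised to mean one, so one application of Markov's inequality treats points
  -- of different norms together, leaving the quadratic offset.
  set f : Vec n → ℝ := fun ξ => ∑ i, Real.exp (-(μ ^ 2 * ‖z i‖ ^ 2 / 2)) *
    Real.exp (μ * inner ℝ (z i) ξ)
  have hi : ∀ i, Integrable (fun ξ => Real.exp (-(μ ^ 2 * ‖z i‖ ^ 2 / 2)) *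
    Real.exp (μ * inner ℝ (z i) ξ)) (stdGaussian (Vec n)) := fun i =>
    (integrable_exp_inner_stdGaussian (z i) μ).const_mul _
  have hint : ∫ ξ, f ξ ∂(stdGaussian (Vec n)) = N := by
    simp only [f]
    rw [integral_finsetSum _ fun i _ => hi i]
    simp_rw [integral_const_mul, integral_exp_inner_stdGaussian, ← Real.exp_add]
    simp [N]
  have hm : Measurable f := by fun_prop
  refine ⟨{ξ | f ξ < N / δ}, measurableSet_lt hm measurable_const, ?_, fun ξ hξ i => ?_⟩
  · have h := one_sub_le_measureReal_lt (fun ξ => by positivity) hm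
      (integrable_finsetSum _ fun i _ => hi i) (c := N / δ) (by positivity)
    rwa [hint, div_div_cancel₀ hN.ne'] at h
  · have h1 : Real.exp (-(μ ^ 2 * ‖z i‖ ^ 2 / 2)) * Real.exp (μ * inner ℝ (z i) ξ) ≤ f ξ :=
      Finset.single_le_sum (f := fun i => Real.exp (-(μ ^ 2 * ‖z i‖ ^ 2 / 2)) *
        Real.exp (μ * inner ℝ (z i) ξ)) (fun _ _ => by positivity) (Finset.mem_univ i)
    have h2 := h1.trans (le_of_lt hξ)
    rw [← Real.exp_add, ← Real.le_log_iff_exp_le (by positivity)] at h2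
    have h3 : μ * inner ℝ (z i) ξ ≤
        μ * (Real.log (N / δ) / μ + μ / 2 * ‖z i‖ ^ 2) := by
      rw [mul_add, mul_div_cancel₀ _ hμ.ne']
      linarith
    exact le_of_mul_le_mul_left h3 hμ

/-- The noise component in a subspace is of the order of its dimension. -/
lemma exists_event_sq_inner_le (W : Submodule ℝ (Vec n)) {δ : ℝ} (hδ : 0 < δ) :
    ∃ E : Set (Vec n), MeasurableSet E ∧ 1 - δ ≤ (stdGaussian (Vec n)).real E ∧
      ∀ ξ ∈ E, ∀ u ∈ W, (inner ℝ u ξ : ℝ) ^ 2 ≤ Module.finrank ℝ W / δ * ‖u‖ ^ 2 := by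
  rcases Nat.eq_zero_or_pos (Module.finrank ℝ W) with h0 | hpos
  · refine ⟨Set.univ, MeasurableSet.univ, by simpa using hδ.le, fun ξ _ u hu => ?_⟩
    rw [Submodule.finrank_eq_zero] at h0
    rw [h0, Submodule.mem_bot] at hu
    simp [hu]
  have hr : (0 : ℝ) < Module.finrank ℝ W := by exact_mod_cast hpos
  let b := stdOrthonormalBasis ℝ W
  -- This is the squared norm of the projected noise, of mean `dim W`. Markov and Cauchy–Schwarz
  -- then handle all of `W` at once.
  set f : Vec n → ℝ := fun ξ => ∑ i, (inner ℝ (b i : Vec n) ξ) ^ 2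
  have hint : ∫ ξ, f ξ ∂(stdGaussian (Vec n)) = Module.finrank ℝ W := by
    simp only [f]
    rw [integral_finsetSum _ fun i _ => integrable_sq_inner_stdGaussian _]
    have hb : ∀ i, ‖(b i : Vec n)‖ = 1 := fun i => b.orthonormal.1 i
    simp_rw [integral_sq_inner_stdGaussian, hb]
    simp
  have hm : Measurable f := by fun_prop
  refine ⟨{ξ | f ξ < Module.finrank ℝ W / δ}, measurableSet_lt hm measurable_const, ?_,
    fun ξ hξ u hu => ?_⟩
  · have h := one_sub_le_measureReal_lt (fun ξ => by positivity) hm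
      (integrable_finsetSum _ fun i _ => integrable_sq_inner_stdGaussian _)
      (c := Module.finrank ℝ W / δ) (by positivity)
    rwa [hint, div_div_cancel₀ hr.ne'] at h
  · have h1 : f ξ = ‖W.orthogonalProjectionOnto ξ‖ ^ 2 := by
      rw [← b.sum_sq_inner_right]
      simp only [f, Submodule.inner_orthogonalProjectionOnto_eq_of_mem_left]
    have h2 : inner ℝ u ξ = inner ℝ (⟨u, hu⟩ : W) (W.orthogonalProjectionOnto ξ) := by
      rw [Submodule.inner_orthogonalProjectionOnto_eq_of_mem_left]
    have h3 := abs_real_inner_le_norm (⟨u, hu⟩ : W) (W.orthogonalProjectionOnto ξ)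
    rw [← h2] at h3
    have h4 := pow_le_pow_left₀ (abs_nonneg _) h3 2
    rw [sq_abs, mul_pow, ← h1, mul_comm, Submodule.coe_norm] at h4
    exact h4.trans (mul_le_mul_of_nonneg_right (le_of_lt hξ) (sq_nonneg _))

end gaussian

/-! ### Maurey's empirical method -/

section maurey

variable {E : Type*} [NormedAddCommGroup E] [InnerProductSpace ℝ E] {ι : Type*} [Fintype ι]
  {w : ι → ℝ} {x : ι → E} {A : ℝ}

lemma exists_le_of_sum_weights (hw : ∀ i, 0 ≤ w i) (hw1 : ∑ i, w i = 1) {f : ι → ℝ} {c : ℝ}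
    (h : c ≤ ∑ i, w i * f i) : ∃ i, c ≤ f i := by
  by_contra! hc
  obtain ⟨i, hi⟩ : ∃ i, 0 < w i := by
    by_contra! h0
    have := Finset.sum_nonpos fun i (_ : i ∈ Finset.univ) => h0 i
    linarith
  have : ∑ i, w i * f i < ∑ i, w i * c :=
    Finset.sum_lt_sum (fun j _ => mul_le_mul_of_nonneg_left (hc j).le (hw j))
      ⟨i, Finset.mem_univ i, mul_lt_mul_of_pos_left (hc i) hi⟩
  rw [← Finset.sum_mul, hw1, one_mul] at this
  linarith

lemma sum_weights_sq_norm_sub_le (hw : ∀ i, 0 ≤ w i) (hw1 : ∑ i, w i = 1)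
    (hx : ∀ i, ‖x i‖ ^ 2 ≤ A) : ∑ i, w i * ‖x i - ∑ j, w j • x j‖ ^ 2 ≤ A := by
  set u := ∑ j, w j • x j with hu
  have h1 : ∑ i, w i * inner ℝ (x i) u = ‖u‖ ^ 2 := by
    simp_rw [← real_inner_smul_left]
    rw [← sum_inner, ← hu, real_inner_self_eq_norm_sq]
  have h2 : ∑ i, w i * ‖x i‖ ^ 2 ≤ A := by
    refine (Finset.sum_le_sum fun i _ => mul_le_mul_of_nonneg_left (hx i) (hw i)).trans ?_
    rw [← Finset.sum_mul, hw1, one_mul]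
  have h3 : ∑ i, w i * ‖x i - u‖ ^ 2 =
      ∑ i, w i * ‖x i‖ ^ 2 - 2 * ∑ i, w i * inner ℝ (x i) u + ‖u‖ ^ 2 * ∑ i, w i := by
    rw [Finset.mul_sum, Finset.mul_sum, ← Finset.sum_sub_distrib, ← Finset.sum_add_distrib]
    refine Finset.sum_congr rfl fun i _ => ?_
    rw [norm_sub_sq_real]
    ring
  rw [h3, h1, hw1]
  nlinarith [sq_nonneg ‖u‖]

/-- Derandomised empirical method of Maurey: greedy choice of atoms whose centred sum does not
decrease a concave quadratic functional by more than the variance. -/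
lemma exists_multiset_le (hw : ∀ i, 0 ≤ w i) (hw1 : ∑ i, w i = 1)
    (hx : ∀ i, ‖x i‖ ^ 2 ≤ A) {κ : ℝ} (hκ : 0 ≤ κ) (g : E) (q : ℕ) :
    ∃ s : Multiset ι, s.card = q ∧
      -(κ * q * A) ≤ inner ℝ g ((s.map x).sum - q • ∑ j, w j • x j) -
        κ * ‖(s.map x).sum - q • ∑ j, w j • x j‖ ^ 2 := by
  induction q with
  | zero => exact ⟨0, by simp⟩
  | succ q ih =>
    obtain ⟨s, hs, h⟩ := ih
    set u := ∑ j, w j • x j with hu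
    set e := (s.map x).sum - q • u
    have hv := sum_weights_sq_norm_sub_le hw hw1 hx
    rw [← hu] at hv
    have hz : ∑ i, w i • (x i - u) = 0 := by
      simp_rw [smul_sub]
      rw [Finset.sum_sub_distrib, ← Finset.sum_smul, hw1, one_smul, ← hu, sub_self]
    have hlin : ∀ y : E, ∑ i, w i * inner ℝ y (x i - u) = 0 := fun y => by
      simp_rw [← real_inner_smul_right]
      rw [← inner_sum, hz, inner_zero_right]
    -- On adding an atom, the linear part of the change has mean zero and the quadratic part costs
    -- at most `κ * A` on average, so some atom does no worse.
    obtain ⟨i, hi⟩ := exists_le_of_sum_weights hw hw1 (c := -(κ * A))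
      (f := fun i => inner ℝ (g - (2 * κ) • e) (x i - u) - κ * ‖x i - u‖ ^ 2) (by
        have e1 : ∑ i, w i * (inner ℝ (g - (2 * κ) • e) (x i - u) - κ * ‖x i - u‖ ^ 2) =
            ∑ i, w i * inner ℝ (g - (2 * κ) • e) (x i - u) -
              κ * ∑ i, w i * ‖x i - u‖ ^ 2 := by
          rw [Finset.mul_sum, ← Finset.sum_sub_distrib]
          exact Finset.sum_congr rfl fun i _ => by ring
        rw [e1, hlin, zero_sub]
        exact neg_le_neg (mul_le_mul_of_nonneg_left hv hκ))
    refine ⟨i ::ₘ s, by simp [hs], ?_⟩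
    have e2 : ((i ::ₘ s).map x).sum - (q + 1) • u = e + (x i - u) := by
      simp only [Multiset.map_cons, Multiset.sum_cons, e, add_smul, one_smul]
      abel
    rw [e2, inner_add_right, norm_add_sq_real]
    rw [inner_sub_left, real_inner_smul_left] at hi
    push_cast
    linarith

/-- A point of the convex hull of bounded atoms is matched, for the functional `⟨ξ, ·⟩ - c ‖·‖²`
and up to an error of order `1 / p`, by an average of `p` atoms. -/
lemma exists_sym_average_le (hw : ∀ i, 0 ≤ w i) (hw1 : ∑ i, w i = 1)
    (hx : ∀ i, ‖x i‖ ^ 2 ≤ A) {c : ℝ} (hc : 0 ≤ c) (ξ : E) {p : ℕ} (hp : 0 < p) :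
    ∃ s : Sym ι p,
      inner ℝ (∑ j, w j • x j) ξ - c * ‖∑ j, w j • x j‖ ^ 2 - c * A / p ≤
        inner ℝ ((1 / (p : ℝ)) • ((s : Multiset ι).map x).sum) ξ -
          c * ‖(1 / (p : ℝ)) • ((s : Multiset ι).map x).sum‖ ^ 2 := by
  have hp' : (0 : ℝ) < p := by exact_mod_cast hp
  set u := ∑ j, w j • x j with hu
  -- These parameters come from expanding `⟨·, ξ⟩ - c‖·‖²` at `u + e / p` around `u` and factoring
  -- out `1 / p`.
  obtain ⟨s, hs, h⟩ := exists_multiset_le hw hw1 hx (κ := c / p) (by positivity)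
    (ξ - (2 * c) • u) p
  rw [← hu] at h
  refine ⟨⟨s, hs⟩, ?_⟩
  simp only [Sym.coe_mk]
  set e := (s.map x).sum - p • u with he
  have e1 : (1 / (p : ℝ)) • (s.map x).sum = u + (1 / (p : ℝ)) • e := by
    rw [he, smul_sub, ← Nat.cast_smul_eq_nsmul ℝ, smul_smul, one_div, inv_mul_cancel₀ hp'.ne',
      one_smul]
    abel
  rw [e1, inner_add_left, norm_add_sq_real, real_inner_smul_left, real_inner_smul_right, norm_smul,
    Real.norm_of_nonneg (by positivity)]
  rw [inner_sub_left, real_inner_smul_left, real_inner_comm e ξ] at h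
  have h2 := div_le_div_of_nonneg_right h hp'.le
  have e3 : -(c / p * p * A) / p = -(c * A / p) := by field_simp
  have e4 : (inner ℝ e ξ - 2 * c * inner ℝ u e - c / p * ‖e‖ ^ 2) / p =
      1 / p * inner ℝ e ξ - c * (2 * (1 / p * inner ℝ u e)) - c * (1 / p * ‖e‖) ^ 2 := by
    field_simp
  rw [e3, e4] at h2
  linarith

/-- Counts multisets by `(N + p)^p / p!` and uses `p! ≥ (p / e)^p`. -/
lemma log_card_sym_le [Nonempty ι] {p : ℕ} (hp : 0 < p) :
    Real.log (Nat.multichoose (Fintype.card ι) p) ≤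
      p * (1 + Real.log ((Fintype.card ι + p) / p)) := by
  set N := Fintype.card ι
  have hN : 0 < N := Fintype.card_pos
  have hp' : (0 : ℝ) < p := by exact_mod_cast hp
  have hN' : (0 : ℝ) < N := by exact_mod_cast hN
  have hf : (0 : ℝ) < p.factorial := by exact_mod_cast p.factorial_pos
  have h1 : ((N.multichoose p : ℕ) : ℝ) ≤ (N + p : ℝ) ^ p / p.factorial := by
    rw [Nat.multichoose_eq]
    refine (Nat.choose_le_pow_div p (N + p - 1)).trans ?_
    have : ((N + p - 1 : ℕ) : ℝ) ≤ (N + p : ℝ) := by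
      have : N + p - 1 ≤ N + p := by omega
      exact_mod_cast this
    gcongr
  have h2 := Real.pow_div_factorial_le_exp (p : ℝ) hp'.le p
  have h3 : (N + p : ℝ) ^ p / p.factorial ≤ Real.exp p * ((N + p) / p) ^ p := by
    rw [div_pow, mul_div_assoc', le_div_iff₀ (by positivity), div_mul_eq_mul_div, div_le_iff₀ hf]
    rw [div_le_iff₀ hf] at h2
    nlinarith [pow_pos (add_pos hN' hp') p]
  have hpos : (0 : ℝ) < (N.multichoose p : ℕ) := by
    have : 0 < N.multichoose p := by
      rw [Nat.multichoose_eq]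
      exact Nat.choose_pos (by omega)
    exact_mod_cast this
  refine (Real.log_le_log hpos (h1.trans h3)).trans ?_
  rw [Real.log_mul (Real.exp_pos _).ne' (by positivity), Real.log_exp, Real.log_pow]
  linarith

end maurey

/-! ### Offset complexity of a convex hull -/

lemma exists_weights_of_mem_convexHull {E ι : Type*} [AddCommGroup E] [Module ℝ E] [Fintype ι]
    {x : ι → E} {u : E} (hu : u ∈ convexHull ℝ (Set.range x)) :
    ∃ w : ι → ℝ, (∀ i, 0 ≤ w i) ∧ ∑ i, w i = 1 ∧ ∑ i, w i • x i = u := by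
  classical
  have h : convexHull ℝ (Set.range x) ⊆ Fintype.linearCombination ℝ x '' stdSimplex ℝ ι := by
    refine convexHull_min ?_ ((convex_stdSimplex ℝ ι).linear_image _)
    rintro _ ⟨i, rfl⟩
    exact ⟨Pi.single i 1, single_mem_stdSimplex ℝ i, by
      rw [Fintype.linearCombination_apply_single, one_smul]⟩
  obtain ⟨w, hw, rfl⟩ := h hu
  exact ⟨w, hw.1, hw.2, (Fintype.linearCombination_apply ℝ x w).symm⟩

/-- Offset Gaussian complexity of the convex hull of `2 M` points of norm at most `38 s`. -/
lemma exists_event_hull {n M : ℕ} {ι : Type*} [Fintype ι] [Nonempty ι]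
    (hcard : Fintype.card ι = 2 * M) (hM : 2 ≤ M) {x : ι → Vec n} {s : ℝ} (hs : 0 < s)
    (hsM : s ≤ M) (hx : ∀ i, ‖x i‖ ≤ 38 * s) :
    ∃ E : Set (Vec n), MeasurableSet E ∧ 1 - 1 / 200 ≤ (stdGaussian (Vec n)).real E ∧
      ∀ ξ ∈ E, ∀ u ∈ convexHull ℝ (Set.range x),
        inner ℝ u ξ - 1 / 4 * ‖u‖ ^ 2 ≤ 730 * (s * √(Real.log (Real.exp 1 * M / s))) := by
  classical
  have hM0 : (0 : ℝ) < M := by positivity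
  set l := Real.log (Real.exp 1 * M / s) with hl
  have hlM : l = 1 + Real.log (M / s) := by
    rw [hl, mul_div_assoc, Real.log_mul (Real.exp_pos 1).ne' (by positivity), Real.log_exp]
  have hl1 : 1 ≤ l := by
    have := Real.log_nonneg ((one_le_div hs).2 hsM)
    linarith
  have hq1 : 1 ≤ √l := Real.one_le_sqrt.2 hl1
  have hq0 : 0 < √l := by linarith
  have hqq : √l * √l = l := Real.mul_self_sqrt (by linarith)
  have hlq : Real.log √l ≤ l / 2 := by
    rw [Real.log_sqrt (by linarith)]
    have := Real.log_le_sub_one_of_pos (show 0 < l by linarith)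
    linarith
  have hx2 : ∀ i, ‖x i‖ ^ 2 ≤ (38 * s) ^ 2 := fun i =>
    pow_le_pow_left₀ (norm_nonneg _) (hx i) 2
  have h400 : Real.log 400 ≤ 6 := by
    rw [Real.log_le_iff_le_exp (by norm_num)]
    have : (2.718 : ℝ) ^ 6 ≤ Real.exp 1 ^ 6 := by
      have := Real.exp_one_gt_d9
      gcongr
      linarith
    rw [← Real.exp_nat_mul] at this
    norm_num at this ⊢
    linarith
  have h200 : Real.log 200 ≤ 6 := (Real.log_le_log (by norm_num) (by norm_num)).trans h400
  have h4 : Real.log 4 ≤ 3 / 2 := by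
    rw [show (4 : ℝ) = 2 ^ 2 by norm_num, Real.log_pow]
    have := Real.log_two_lt_d9
    push_cast
    linarith
  rcases le_or_gt (√l) s with hcase | hcase
  -- This size balances the Maurey error, of order `s² / p`, against the log-cardinality, of order
  -- `p * l`. The case hypothesis keeps rounding within a factor two.
  · set p := ⌈s / √l⌉₊ with hp
    have hr1 : 1 ≤ s / √l := (one_le_div hq0).2 hcase
    have hp1 : s / √l ≤ p := Nat.le_ceil _
    have hp2 : (p : ℝ) ≤ 2 * (s / √l) := by
      have := Nat.ceil_lt_add_one (show 0 ≤ s / √l by positivity)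
      linarith
    have hp0 : (0 : ℝ) < p := by linarith
    have hpN : 0 < p := by exact_mod_cast hp0
    have hsq : s / √l * l = s * √l := by
      rw [div_mul_eq_mul_div, div_eq_iff hq0.ne']
      rw [mul_assoc, hqq]
    have hcardN : 0 < Fintype.card ι := Fintype.card_pos
    have hmc : (0 : ℝ) < Nat.multichoose (Fintype.card ι) p := by
      rw [Nat.multichoose_eq]
      exact Nat.cast_pos.2 (Nat.choose_pos (by omega))
    have hNe : Nonempty (Sym ι p) := by
      rw [← Fintype.card_pos_iff, Sym.card_sym_eq_multichoose]
      exact_mod_cast hmc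
    have hlog : Real.log (Nat.multichoose (Fintype.card ι) p) ≤ 6 * (s * √l) := by
      refine (log_card_sym_le hpN).trans ?_
      have h1 : Real.log ((Fintype.card ι + p : ℝ) / p) ≤ 3 / 2 + (l - 1) + l / 2 := by
        have h2 : (Fintype.card ι + p : ℝ) / p ≤ 4 * (M / s) * √l := by
          rw [hcard, div_le_iff₀ hp0]
          push_cast
          have h3 : (p : ℝ) ≤ 2 * M := by
            have : s / √l ≤ s := div_le_self hs.le hq1
            linarith
          have h5 : 4 * (M : ℝ) ≤ 4 * (M / s) * √l * p := by
            have h6 : 4 * (M / s) * √l * (s / √l) = 4 * (M : ℝ) := by field_simp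
            rw [← h6]
            gcongr
          linarith
        refine (Real.log_le_log (by positivity) h2).trans ?_
        rw [Real.log_mul (by positivity) hq0.ne', Real.log_mul (by norm_num) (by positivity)]
        linarith
      calc (p : ℝ) * (1 + Real.log ((Fintype.card ι + p : ℝ) / p))
          ≤ p * (3 * l) := by gcongr; linarith
        _ ≤ 2 * (s / √l) * (3 * l) := by gcongr
        _ = 6 * (s * √l) := by rw [← hsq]; ring
    obtain ⟨E, hE, hPE, hb⟩ := exists_event_forall_inner_le
      (fun t : Sym ι p => (1 / (p : ℝ)) • ((t : Multiset ι).map x).sum)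
      -- The choice `μ / 2 = 1 / 4` makes the union bound's quadratic term match the offset.
      (μ := 1 / 2) (δ := 1 / 200) (by norm_num) (by norm_num)
    refine ⟨E, hE, hPE, fun ξ hξ u hu => ?_⟩
    obtain ⟨w, hw, hw1, rfl⟩ := exists_weights_of_mem_convexHull hu
    obtain ⟨t, ht⟩ := exists_sym_average_le hw hw1 hx2 (c := 1 / 4) (by norm_num) ξ hpN
    have h1 := hb ξ hξ t
    rw [Sym.card_sym_eq_multichoose, div_div_eq_mul_div (_ : ℝ) 1 200, div_one,
      Real.log_mul hmc.ne' (by norm_num)] at h1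
    have h2 : 1 / 4 * (38 * s) ^ 2 / p ≤ 361 * (s * √l) := by
      rw [div_le_iff₀ hp0]
      have : s = √l * (s / √l) := by field_simp
      have : s ≤ √l * p := by
        rw [this]
        gcongr
      nlinarith
    have h3 : 1 ≤ s * √l := by nlinarith
    linarith
  -- For small `s` a union bound over the atoms suffices, without the offset; this `μ` balances its
  -- two terms, and the bound extends to the hull by linearity.
  · have hμ : 0 < √l / s := by positivity
    obtain ⟨E, hE, hPE, hb⟩ := exists_event_forall_inner_le x
      (μ := √l / s) (δ := 1 / 200) hμ (by norm_num)
    refine ⟨E, hE, hPE, fun ξ hξ u hu => ?_⟩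
    have hlogN : Real.log ((Fintype.card ι : ℝ) / (1 / 200)) ≤ 8 * l := by
      rw [hcard]
      have e : ((2 * M : ℕ) : ℝ) / (1 / 200) = 400 * ((M / s) * s) := by
        push_cast
        field_simp
        ring
      rw [e, Real.log_mul (by norm_num) (by positivity), Real.log_mul (by positivity) hs.ne']
      have := Real.log_le_log hs hcase.le
      linarith
    have hpt : ∀ i, inner ℝ (x i) ξ ≤ 730 * (s * √l) := fun i => by
      refine (hb ξ hξ i).trans ?_
      have h1 : Real.log ((Fintype.card ι : ℝ) / (1 / 200)) / (√l / s) ≤ 8 * (s * √l) := by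
        rw [div_le_iff₀ hμ]
        have : 8 * (s * √l) * (√l / s) = 8 * (√l * √l) := by field_simp
        rw [this, hqq]
        exact hlogN
      have h2 : √l / s / 2 * ‖x i‖ ^ 2 ≤ 722 * (s * √l) := by
        calc √l / s / 2 * ‖x i‖ ^ 2 ≤ √l / s / 2 * (38 * s) ^ 2 := by
              gcongr
              exact hx i
          _ = 722 * (s * √l) := by field_simp; norm_num
      linarith
    obtain ⟨w, hw, hw1, rfl⟩ := exists_weights_of_mem_convexHull hu
    have h1 : inner ℝ (∑ i, w i • x i) ξ ≤ 730 * (s * √l) := by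
      rw [sum_inner]
      calc ∑ i, inner ℝ (w i • x i) ξ ≤ ∑ i, w i * (730 * (s * √l)) := by
            refine Finset.sum_le_sum fun i _ => ?_
            rw [real_inner_smul_left]
            exact mul_le_mul_of_nonneg_left (hpt i) (hw i)
        _ = 730 * (s * √l) := by rw [← Finset.sum_mul, hw1, one_mul]
    nlinarith [sq_nonneg ‖∑ i, w i • x i‖]

/-! ### From noise bounds to the risk -/

section rate

variable {n d m M : ℕ} {k : Fin M → Vec d} {X : Matrix (Fin n) (Fin d) ℝ} {τ : ℝ}

lemma hullPhi_mul_sqrt (hn : 0 < n) : hullPhi X k * √(n : ℝ) = ⨆ i, ‖apply X (k i)‖ := by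
  have : (0 : ℝ) < n := by exact_mod_cast hn
  exact div_mul_cancel₀ _ (Real.sqrt_pos.2 this).ne'

lemma hullRate_eq (hn : 0 < n) {s : ℝ} (hs : s = τ * hullPhi X k * √(n : ℝ)) :
    hullRate X k τ 3 =
      min ((X.rank : ℝ) / n) (3 * (s * √(Real.log (Real.exp 1 * M / s))) / n) := by
  have hn' : (0 : ℝ) < n := by exact_mod_cast hn
  have hq := Real.sqrt_pos.2 hn'
  have hqq := Real.mul_self_sqrt hn'.le
  rw [hullRate, ← hs, Real.sqrt_div' _ hn'.le]
  congr 1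
  rw [eq_div_iff hn'.ne']
  generalize √(Real.log (Real.exp 1 * M / s)) = L
  rw [hs]
  calc 3 * τ * hullPhi X k * (L / √(n : ℝ)) * n
      = 3 * τ * hullPhi X k * (L / √(n : ℝ)) * (√(n : ℝ) * √(n : ℝ)) := by rw [hqq]
    _ = 3 * (τ * hullPhi X k * √(n : ℝ) * L) := by field_simp

lemma norm_apply_le (i : Fin M) : ‖apply X (k i)‖ ≤ ⨆ i, ‖apply X (k i)‖ :=
  le_ciSup (Set.finite_range fun i => ‖apply X (k i)‖).bddAbove i

/-- If all the points `X k_i` vanish then `X = 0`. -/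
lemma apply_eq_zero_of_iSup (h0 : (0 : Vec d) ∈ interior (mHull k))
    (h : ⨆ i, ‖apply X (k i)‖ ≤ 0) (v : Vec d) : apply X v = 0 := by
  have hz : ∀ x ∈ mHull k, apply X x = 0 := by
    have hc : Convex ℝ {x | apply X x = 0} := by
      intro x hx y hy a b _ _ _
      rw [Set.mem_ofPred_eq] at *
      rw [apply_add, apply_smul, apply_smul, hx, hy, smul_zero, smul_zero, add_zero]
    refine fun x hx => convexHull_min ?_ hc hx
    rintro _ ⟨i, rfl⟩
    exact norm_le_zero_iff.1 ((norm_apply_le i).trans h)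
  obtain ⟨c, _, _, x, hx, rfl⟩ :=
    exists_lt_of_gauge_lt (absorbent_mHull h0) (lt_add_one (gauge (mHull k) v))
  simp only [apply_smul, hz x hx, smul_zero]

lemma two_le_card (hd : 0 < d) (h0 : (0 : Vec d) ∈ interior (mHull k)) : 2 ≤ M := by
  by_contra! hM
  obtain ⟨i, hi⟩ := exists_ne_zero_of_mHull hd h0
  have h1 : M = 1 := by
    have := i.pos
    omega
  subst h1
  have h2 : mHull k = {k 0} := by
    rw [mHull, Set.range_unique, convexHull_singleton]
    rfl
  have h3 := interior_subset h0
  rw [h2, Set.mem_singleton_iff] at h3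
  exact hi (by rw [Subsingleton.elim i 0, ← h3])

lemma rank_eq_finrank_range_toEuclideanLin :
    X.rank = Module.finrank ℝ (LinearMap.range (Matrix.toEuclideanLin X)) := by
  rw [Matrix.rank_eq_finrank_range_toLin X (PiLp.basisFun 2 ℝ (Fin n)) (PiLp.basisFun 2 ℝ (Fin d)),
    ← Matrix.toLpLin_eq_toLin]

lemma apply_mem_range (v : Vec d) : apply X v ∈ LinearMap.range (Matrix.toEuclideanLin X) :=
  ⟨v, rfl⟩

lemma mem_smul_of_gauge_lt (h0 : (0 : Vec d) ∈ interior (mHull k)) {c : ℝ} {v : Vec d}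
    (h : gauge (mHull k) v < c) : v ∈ c • mHull k := by
  obtain ⟨b, hb, hbc, hv⟩ := exists_lt_of_gauge_lt (absorbent_mHull h0) h
  have hc : 0 < c := hb.trans hbc
  obtain ⟨x, hx, rfl⟩ := hv
  refine ⟨(b / c) • x, ?_, ?_⟩
  · exact (convex_convexHull ℝ _).smul_mem_of_zero_mem (interior_subset h0) hx
      ⟨by positivity, (div_le_one hc).2 hbc.le⟩
  · simp only [smul_smul, mul_div_cancel₀ _ hc.ne']

/-- The images of the differences between the relevant iterates and the signal lie in the convex
hull of the symmetrised and rescaled points `X k_i`. -/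
lemma apply_sub_mem_convexHull {α β : Vec d} (hα : α ∈ (37 * τ) • mHull k) (hβ : β ∈ τ • mHull k) :
    apply X (α - β) ∈ convexHull ℝ (Set.range (Sum.elim
      (fun i => (38 * τ) • apply X (k i)) (fun i => -((38 * τ) • apply X (k i))))) := by
  obtain ⟨a, ha, rfl⟩ := hα
  obtain ⟨b, hb, rfl⟩ := hβ
  set S := convexHull ℝ (Set.range (Sum.elim
      (fun i => (38 * τ) • apply X (k i)) (fun i => -((38 * τ) • apply X (k i))))) with hS
  have hconv : Convex ℝ S := convex_convexHull ℝ _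
  have h1 : ∀ y ∈ mHull k, (38 * τ) • apply X y ∈ S := by
    intro y hy
    have hc : Convex ℝ (((38 * τ) • Matrix.toEuclideanLin X) ⁻¹' S) := hconv.linear_preimage _
    refine convexHull_min ?_ hc hy
    rintro _ ⟨i, rfl⟩
    exact subset_convexHull ℝ _ ⟨Sum.inl i, rfl⟩
  have h2 : ∀ y ∈ mHull k, -((38 * τ) • apply X y) ∈ S := by
    intro y hy
    have hc : Convex ℝ ((-((38 * τ) • Matrix.toEuclideanLin X)) ⁻¹' S) := hconv.linear_preimage _
    refine convexHull_min ?_ hc hy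
    rintro _ ⟨i, rfl⟩
    exact subset_convexHull ℝ _ ⟨Sum.inr i, rfl⟩
  -- The dilations `37τ` and `τ` add up to `38τ`, whence the weights.
  have h3 := hconv (h1 a ha) (h2 b hb) (show (0 : ℝ) ≤ 37 / 38 by norm_num)
    (show (0 : ℝ) ≤ 1 / 38 by norm_num) (by norm_num)
  convert h3 using 1
  simp only [apply_sub, apply_smul, smul_neg, smul_smul]
  rw [← sub_eq_add_neg]
  congr 2 <;> ring

lemma empiricalRisk_sub (α β : Vec d) (ξ : Vec n) :
    empiricalRisk X (apply X β + ξ) α - empiricalRisk X (apply X β + ξ) β =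
      1 / n * (‖apply X (α - β)‖ ^ 2 - 2 * inner ℝ (apply X (α - β)) ξ) := by
  have e1 : apply X α - (apply X β + ξ) = apply X (α - β) - ξ := by
    rw [apply_sub]; abel
  have e2 : apply X β - (apply X β + ξ) = -ξ := by abel
  rw [empiricalRisk, empiricalRisk, e1, e2, norm_neg, norm_sub_sq_real]
  ring

end rate

/-- With high probability over the noise, every vector in a multiple of the hull whose empirical
excess risk is below the rate has in-sample risk of the order of the rate, and the empirical excess
risk is bounded below. -/
lemma exists_event_risk {n d M : ℕ} (hn : 0 < n) (hd : 0 < d) {k : Fin M → Vec d}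
    (h0 : (0 : Vec d) ∈ interior (mHull k)) {τ : ℝ} (hτ : 0 < τ) (X : Matrix (Fin n) (Fin d) ℝ)
    (hM : τ * hullPhi X k * √(n : ℝ) ≤ M) (hX : 0 < ⨆ i, ‖apply X (k i)‖) :
    0 < hullRate X k τ 3 ∧
    ∃ E : Set (Vec n), MeasurableSet E ∧ 0.99 ≤ (stdGaussian (Vec n)).real E ∧
      ∀ ξ ∈ E, ∀ β ∈ τ • mHull k,
        (∀ α, -200 ≤ empiricalRisk X (apply X β + ξ) α - empiricalRisk X (apply X β + ξ) β) ∧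
        ∀ α ∈ (37 * τ) • mHull k,
          empiricalRisk X (apply X β + ξ) α - empiricalRisk X (apply X β + ξ) β ≤
            hullRate X k τ 3 →
          inSampleRisk X β α ≤ 1000 * hullRate X k τ 3 := by
  have hn' : (0 : ℝ) < n := by exact_mod_cast hn
  have hM2 := two_le_card hd h0
  set s := τ * hullPhi X k * √(n : ℝ) with hs
  have hs' : s = τ * ⨆ i, ‖apply X (k i)‖ := by rw [hs, mul_assoc, hullPhi_mul_sqrt hn]
  have hs0 : 0 < s := by rw [hs']; positivity
  have hrate := hullRate_eq (X := X) (k := k) hn hs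
  set L := √(Real.log (Real.exp 1 * M / s)) with hL
  have hL0 : 0 < L := by
    refine Real.sqrt_pos.2 (Real.log_pos ?_)
    rw [one_lt_div hs0]
    have := Real.exp_one_gt_d9
    nlinarith
  set W := LinearMap.range (Matrix.toEuclideanLin X) with hW
  have hr : X.rank = Module.finrank ℝ W := rank_eq_finrank_range_toEuclideanLin
  have hr1 : 0 < X.rank := by
    rw [hr, Nat.pos_iff_ne_zero]
    intro h
    rw [Submodule.finrank_eq_zero] at h
    have : ∀ v, apply X v = 0 := fun v => by
      have := apply_mem_range (X := X) v
      rwa [← hW, h, Submodule.mem_bot] at this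
    simp [this] at hX
  have hr0 : (0 : ℝ) < X.rank := by exact_mod_cast hr1
  have hrn : (X.rank : ℝ) ≤ n := by exact_mod_cast Matrix.rank_le_height X
  refine ⟨by rw [hrate]; positivity, ?_⟩
  obtain ⟨E₁, hE₁, hP₁, hb₁⟩ := exists_event_sq_inner_le W (δ := 1 / 200) (by norm_num)
  have hne : Nonempty (Fin M ⊕ Fin M) := ⟨Sum.inl ⟨0, by omega⟩⟩
  have hx : ∀ i : Fin M, ‖(38 * τ) • apply X (k i)‖ ≤ 38 * s := fun i => by
    rw [norm_smul, Real.norm_of_nonneg (by positivity), hs', ← mul_assoc]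
    exact mul_le_mul_of_nonneg_left (norm_apply_le i) (by positivity)
  obtain ⟨E₂, hE₂, hP₂, hb₂⟩ := exists_event_hull (n := n) (M := M)
    (x := Sum.elim (fun i => (38 * τ) • apply X (k i)) (fun i => -((38 * τ) • apply X (k i))))
    (by simp; ring) hM2 hs0 hM (by
      rintro (i | i)
      · exact hx i
      · simpa using hx i)
  refine ⟨E₁ ∩ E₂, hE₁.inter hE₂, ?_, fun ξ hξ β hβ => ?_⟩
  · have h1 : (stdGaussian (Vec n)).real (E₁ ∩ E₂)ᶜ ≤
        (stdGaussian (Vec n)).real E₁ᶜ + (stdGaussian (Vec n)).real E₂ᶜ := by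
      rw [Set.compl_inter]
      exact measureReal_union_le _ _
    rw [probReal_compl_eq_one_sub (hE₁.inter hE₂), probReal_compl_eq_one_sub hE₁,
      probReal_compl_eq_one_sub hE₂] at h1
    norm_num at h1 hP₁ hP₂ ⊢
    linarith
  have hsq : ∀ α, (inner ℝ (apply X (α - β)) ξ : ℝ) ^ 2 ≤
      200 * X.rank * ‖apply X (α - β)‖ ^ 2 := fun α => by
    have := hb₁ ξ hξ.1 _ (apply_mem_range (X := X) (α - β))
    rw [← hr] at this
    linarith
  have hlin : ∀ (α : Vec d) (c : ℝ), 0 < c → 2 * inner ℝ (apply X (α - β)) ξ ≤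
      c * ‖apply X (α - β)‖ ^ 2 + 200 * X.rank / c := fun α c hc => by
    have h1 := hsq α
    set v := ‖apply X (α - β)‖
    have hv : 0 ≤ v := norm_nonneg _
    have e : 0 ≤ c * v ^ 2 + 200 * X.rank / c := by positivity
    refine le_of_abs_le (abs_le_of_sq_le_sq ?_ e)
    have h2 : (c * v ^ 2 + 200 * X.rank / c) ^ 2 =
        (c * v ^ 2 - 200 * X.rank / c) ^ 2 + 4 * (200 * X.rank * v ^ 2) := by
      field_simp
      ring
    nlinarith [sq_nonneg (c * v ^ 2 - 200 * X.rank / c)]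
  refine ⟨fun α => ?_, fun α hα hN => ?_⟩
  · rw [empiricalRisk_sub]
    have h1 := hlin α 1 one_pos
    rw [one_div, inv_mul_eq_div, le_div_iff₀ hn']
    linarith
  · rw [empiricalRisk_sub, one_div, inv_mul_eq_div, div_le_iff₀ hn'] at hN
    have h1 := hlin α (1 / 2) (by norm_num)
    have h2 := hb₂ ξ hξ.2 _ (apply_sub_mem_convexHull hα hβ)
    set v := ‖apply X (α - β)‖ ^ 2
    set B := hullRate X k τ 3
    have hv1 : 1 / n * v - 2 * B ≤ 800 * (X.rank / n) := by
      have : v ≤ 2 * B * n + 800 * X.rank := by linarith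
      rw [one_div, inv_mul_eq_div, mul_div_assoc', sub_le_iff_le_add, div_le_iff₀ hn', add_mul,
        div_mul_cancel₀ _ hn'.ne']
      linarith
    have hv2 : 1 / n * v - 2 * B ≤ 980 * (3 * (s * L) / n) := by
      have hsL : 0 < s * L := by positivity
      have : v ≤ 2 * B * n + 2920 * (s * L) := by linarith
      rw [one_div, inv_mul_eq_div, mul_div_assoc', sub_le_iff_le_add, div_le_iff₀ hn', add_mul,
        div_mul_cancel₀ _ hn'.ne']
      linarith
    -- The constant `980` dominates both `800` and `2920 / 3`, so both bounds can be compared with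
    -- the minimum defining `B`.
    have hB : (1 / n * v - 2 * B) / 980 ≤ B := by
      rw [hrate]
      refine le_min ?_ ?_
      · have : (0 : ℝ) ≤ X.rank / n := by positivity
        linarith
      · linarith
    have hB0 : 0 ≤ B := by rw [hrate]; positivity
    rw [inSampleRisk]
    linarith

end ESMD

/-! ### The main result -/

theorem proposition4p2 :
    ∃ C : ℝ, 0 < C ∧
    ∀ (n d m M : ℕ), 0 < n → 0 < d →
    ∀ (k : Fin M → Vec d), (0 : Vec d) ∈ interior (mHull k) →
    ∀ (a : Fin m → Vec d), (∀ α : Vec d, gauge (mHull k) α = ⨆ i, inner ℝ (a i) α) →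
      ∑ i, a i = 0 →
    ∀ (τ γ : ℝ), 0 < τ → 2 * Real.log m / τ ≤ γ →
    ∀ ψ : Vec d → ℝ, ψ = lsePotential a γ (hullRho k) →
      -- the potential satisfies both versions of the conditions with `c_l = 1`, `c_u = 3`,
      -- so that `c_a = c_l * c_u = 3`, and mirror descent with it is well defined
      ContinuousTimeConditions (mHull k) τ 1 3 ψ ∧
      DiscreteTimeConditions (mHull k) τ 1 3 (hullRho k) ψ ∧
      IsContinuousTimeMirrorMap ψ ∧
      IsDiscreteTimeMirrorMap ψ ∧
      -- risk bound for optimally stopped mirror descent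
      ∀ X : Matrix (Fin n) (Fin d) ℝ, τ * hullPhi X k * √(n : ℝ) ≤ (M : ℝ) →
        ∃ E : Set (Vec n), MeasurableSet E ∧
          0.99 - Real.exp (-0.1 * n) ≤ (ProbabilityTheory.stdGaussian (Vec n)).real E ∧
          ∀ ξ ∈ E, ∀ αstar ∈ τ • mHull k,
            -- continuous time, horizon `T ≥ c_u² τ² / rate`
            (∀ α : ℝ → Vec d,
              IsContinuousTimeMD ψ (empiricalRisk X (apply X αstar + ξ)) α →
              ∀ T : ℝ, 3 ^ 2 * τ ^ 2 / hullRate X k τ 3 ≤ T →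
                ∃ tstar ∈ Set.Icc (0 : ℝ) T,
                  IsMinOn (fun t => inSampleRisk X αstar (α t)) (Set.Icc 0 T) tstar ∧
                  inSampleRisk X αstar (α tstar) ≤ C * hullRate X k τ 3) ∧
            -- discrete time, horizon `T ≥ ⌈2 c_u² τ² / (rate * η)⌉`
            (∀ β η : ℝ, 0 < β → IsSmooth β (empiricalRisk X (apply X αstar + ξ)) →
              0 < η → η ≤ hullRho k / β → (αstar ≠ 0 → η ≤ bregman ψ αstar 0 / 2) →
              ∀ α : ℕ → Vec d,
                IsDiscreteTimeMD ψ (empiricalRisk X (apply X αstar + ξ)) η α →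
                ∀ T : ℕ, 2 * 3 ^ 2 * τ ^ 2 / (hullRate X k τ 3 * η) ≤ (T : ℝ) →
                  ∃ tstar ∈ Set.Iic T,
                    IsMinOn (fun t => inSampleRisk X αstar (α t)) (Set.Iic T) tstar ∧
                    inSampleRisk X αstar (α tstar) ≤ C * hullRate X k τ 3) := by
  refine ⟨1000, by norm_num, fun n d m M hn hd k h0 a hg ha τ γ hτ hγ ψ hψ => ?_⟩
  obtain ⟨hct, hdt, hcm, hdm, hbr, hψ0⟩ := lsePotential_spec hd h0 hg ha hτ hγ hψ
  refine ⟨hct, hdt, hcm, hdm, fun X hM => ?_⟩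
  have hbr0 := bregman_nonneg_of_sqrt hbr
  -- it suffices to exhibit a good time, as the risk is continuous along the path
  have hcts : ∀ {αstar : Vec d} {f : Vec d → ℝ} {α : ℝ → Vec d} {T : ℝ},
      IsContinuousTimeMD ψ f α → (∃ t ∈ Set.Icc (0 : ℝ) T,
        inSampleRisk X αstar (α t) ≤ 1000 * hullRate X k τ 3) →
      ∃ tstar ∈ Set.Icc (0 : ℝ) T,
        IsMinOn (fun t => inSampleRisk X αstar (α t)) (Set.Icc 0 T) tstar ∧
        inSampleRisk X αstar (α tstar) ≤ 1000 * hullRate X k τ 3 := by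
    rintro αstar f α T hα ⟨t, ht, hle⟩
    have hc : ContinuousOn α (Set.Icc 0 T) := fun t ht =>
      ((hα.2 t ht.1).continuousWithinAt).mono Set.Icc_subset_Ici_self
    have hR : Continuous (inSampleRisk X αstar) := by
      unfold inSampleRisk
      simp only [apply_eq]
      fun_prop
    obtain ⟨u, hu, hmin⟩ := isCompact_Icc.exists_isMinOn ⟨t, ht⟩ (hR.comp_continuousOn hc)
    exact ⟨u, hu, hmin, (hmin ht).trans hle⟩
  have hdis : ∀ {αstar : Vec d} {α : ℕ → Vec d} {T : ℕ},
      (∃ t ≤ T, inSampleRisk X αstar (α t) ≤ 1000 * hullRate X k τ 3) →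
      ∃ tstar ∈ Set.Iic T,
        IsMinOn (fun t => inSampleRisk X αstar (α t)) (Set.Iic T) tstar ∧
        inSampleRisk X αstar (α tstar) ≤ 1000 * hullRate X k τ 3 := by
    rintro αstar α T ⟨t, ht, hle⟩
    obtain ⟨u, hu, hmin⟩ := (Set.finite_Iic T).exists_minimalFor
      (fun t => inSampleRisk X αstar (α t)) _ ⟨t, ht⟩
    have hmin' : IsMinOn (fun t => inSampleRisk X αstar (α t)) (Set.Iic T) u := fun v hv =>
      (le_total _ _).elim id (hmin hv)
    exact ⟨u, hu, hmin', (hmin' ht).trans hle⟩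
  rcases le_or_gt (⨆ i, ‖apply X (k i)‖) 0 with hX | hX
  · have hz := apply_eq_zero_of_iSup h0 hX
    have hR : ∀ x y, inSampleRisk X x y = 0 := fun x y => by simp [inSampleRisk, hz]
    have hB : hullRate X k τ 3 = 0 := by
      have h1 : ⨆ i, ‖apply X (k i)‖ = 0 := by simp [hz]
      have h2 : hullPhi X k = 0 := by rw [hullPhi, h1, zero_div]
      rw [hullRate, h2]
      simp only [mul_zero, zero_mul]
      exact min_eq_right (by positivity)
    refine ⟨Set.univ, MeasurableSet.univ, ?_, fun ξ _ αstar _ => ⟨fun α hα T hT => ?_,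
      fun β η _ _ _ _ _ α _ T _ => ?_⟩⟩
    · have := Real.exp_pos (-0.1 * n)
      rw [MeasureTheory.probReal_univ]
      linarith
    -- At rate zero, division by zero reduces the horizon condition to `0 ≤ T`.
    · rw [hB, div_zero] at hT
      exact hcts hα ⟨0, ⟨le_rfl, hT⟩, by rw [hR, hB, mul_zero]⟩
    · exact hdis ⟨0, T.zero_le, by rw [hR, hB, mul_zero]⟩
  obtain ⟨hB, E, hE, hPE, hrisk⟩ := exists_event_risk hn hd h0 hτ X hM hX
  refine ⟨E, hE, ?_, fun ξ hξ αstar hstar => ?_⟩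
  · have := Real.exp_pos (-0.1 * n)
    linarith
  obtain ⟨hlow, hup⟩ := hrisk ξ hξ αstar hstar
  have hroot : √(ψ αstar) ≤ 3 * τ := hct.approximates.2.2.2 αstar hstar
  have hψs : ψ αstar ≤ 9 * τ ^ 2 := by
    rw [Real.sqrt_le_left (by positivity)] at hroot
    linarith
  -- Strict because `ψ 0 > 0`; this allows the horizon inequality itself to be non-strict.
  have hD0 : bregman ψ αstar 0 < 9 * τ ^ 2 := by
    rw [bregman_zero hct.gradient_zero]
    linarith
  -- In discrete time the divergence is at most `D + 200η ≤ 101D`, as `η ≤ D / 2`. Since `909 ≤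
  -- 33²`, the gauge is at most `3τ + 33τ < 37τ`.
  have hmem : ∀ α, bregman ψ αstar α ≤ 101 * (9 * τ ^ 2) → α ∈ (37 * τ) • mHull k := by
    intro α hα
    refine mem_smul_of_gauge_lt h0 ?_
    have h1 := hct.approximates.2.2.1 α
    have h2 := (hbr αstar α).trans hα
    have h3 : |√(ψ αstar) - √(ψ α)| ≤ 33 * τ := by
      refine abs_le_of_sq_le_sq ?_ (by positivity)
      nlinarith [sq_nonneg τ]
    have := (abs_le.1 h3).1
    linarith
  refine ⟨fun α hα T hT => ?_, fun β η hβ hs hη hηρ hηD α hα T hT => ?_⟩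
  · have hT0 : 0 ≤ T := le_trans (by positivity) hT
    rw [div_le_iff₀ hB] at hT
    obtain ⟨t, ht, hN, hD⟩ := hα.exists_le hcm hbr0 hB.le hT0 (z := αstar)
      (hD0.trans_le (by linarith))
    exact hcts hα ⟨t, ht, hup _ (hmem _ (by nlinarith [sq_nonneg τ])) hN⟩
  -- For `α⋆ = 0` the step size is not bounded by the divergence, but the starting point already has
  -- zero risk.
  · by_cases hz : αstar = 0
    · refine hdis ⟨0, T.zero_le, ?_⟩
      rw [hα.1, hz, inSampleRisk, sub_zero, apply_eq, map_zero]
      simpa using hB.le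
    · rw [div_le_iff₀ (by positivity)] at hT
      obtain ⟨t, ht, hN, hD⟩ := hα.exists_le hη hβ hηρ hdt.stronglyConvex hbr0 hs hB.le hlow
        (z := αstar) (T := T) (hD0.trans_le (by nlinarith [sq_nonneg τ]))
      have := hηD hz
      exact hdis ⟨t, ht, hup _ (hmem _ (by linarith)) hN⟩
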